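/- An alternating pushdown system (APS) is a tuple $\mathcal{A}=(Q,\Gamma,\Delta,\mathit{init},\mathit{fin})$, where $Q$ is a finite set of states, $\Gamma$ is a finite stack alphabet with a distinguished letter $\bot\in\Gamma$, $\mathit{init},\mathit{fin}\in Q$, and $\Delta$ is a finite set of transitions $(q,A)\hookrightarrow\{(q_1,\gamma_1),\dots,(q_\ell,\gamma_\ell)\}$ with $q,q_i\in Q$, $A\in\Gamma$, $\gamma_i\in\Gamma^*$. A configuration is a pair $(q,\gamma)\in Q\times\Gamma^*$ (the first letter of $\gamma$ is the top of the stack). An accepting run of $\mathcal{A}$ is a finite tree with vertices labelled by configurations such that the root is labelled by $(\mathit{init},\bot)$; for every internal vertex $v$ there are a transition $(p,A)\hookrightarrow\{(p_1,\gamma_1),\dots,(p_\ell,\gamma_\ell)\}$ in $\Delta$ and a word $\gamma$ such that $v$ is labelled by $(p,A\gamma)$ and has exactly $\ell$ children, labelled by $(p_1,\gamma_1\gamma),\dots,(p_\ell,\gamma_\ell\gamma)$; and all leaves are labelled by $(\mathit{fin},\bot)$. The size of $\mathcal{A}$ is $$|\mathcal{A}| = |Q|+|\Gamma|+\sum_{((q,A)\hookrightarrow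 T)\in\Delta}\Big(2+\sum_{(p,\gamma)\in T}(1+|\gamma|)\Big).$$ The problem Sparse-Empty is: given an APS $\mathcal{A}$ and a number $k\in\mathbb{N}$ in unary, decide whether $\mathcal{A}$ has an accepting run with at most $k$ leaves. Theorem. There are an algorithm and a fixed constant $c$ such that the algorithm solves Sparse-Empty on every instance $(\mathcal{A},k)$ in time $O\big(|\mathcal{A}|^{ck^2}\big)$, where the implied constant depends neither on $\mathcal{A}$ nor on $k$. Here an algorithm is a program of the WHILE language over binary trees (assignments of expressions built from variables, $\mathrm{nil}$, $\mathrm{cons}$, $\mathrm{hd}$, $\mathrm{tl}$; sequencing; conditionals and while loops with tests for $\mathrm{nil}$), every elementary operation costs one time unit, and the instance is given as the list of $k$, $|Q|$, $|\Gamma|$, $\mathit{init}$, $\mathit{fin}$, $\bot$ and the transitions in any order, with states and letters numbered arbitrarily and all numbers written in unary. -/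

import Mathlib

namespace SparseEmpty

/-! ### Alternating pushdown systems and their runs -/

/-- An alternating pushdown system with states `Q` and stack alphabet `Γ`. An element `(q, a, T)` of
`trans` is the transition `(q, a) ↪ T`, where `T` is a finite set of pairs (state, pushed word).
The first letter of a word is the top of the stack. -/
structure APS (Q Γ : Type*) where
  trans : Finset (Q × Γ × Finset (Q × List Γ))
  initial : Q
  final : Q
  bot : Γ

/-- Finite ordered trees whose vertices are labelled by elements of `C`. -/
inductive LTree (C : Type*) where
  | node (label : C) (children : List (LTree C)) : LTree C

namespace LTree

variable {C : Type*}

/-- The label of the root. -/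
def label : LTree C → C
  | node c _ => c

/-- The number of leaves, i.e. of vertices without children. -/
def numLeaves : LTree C → ℕ
  | node _ cs => if cs.isEmpty then 1 else (cs.map numLeaves).sum

end LTree

namespace APS

variable {Q Γ : Type*}

/-- `A.IsRun c t`: the labelled tree `t` is a run of `A` (from the label of its root) to the
configuration `c`. A leaf has to be labelled by `c`; at an internal vertex some transition is
applied, and there is exactly one child for each element of the right-hand side. -/
inductive IsRun (A : APS Q Γ) (c : Q × List Γ) : LTree (Q × List Γ) → Prop where
  | leaf : IsRun A c (LTree.node c [])
  | fork (p : Q) (a : Γ) (γ : List Γ) (T : Finset (Q × List Γ)) (cs : List (LTree (Q × List Γ)))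
      (hT : (p, a, T) ∈ A.trans) (hne : cs ≠ [])
      (hlabels : (↑(cs.map LTree.label) : Multiset (Q × List Γ)) =
        T.val.map fun u => (u.1, u.2 ++ γ))
      (hcs : ∀ t ∈ cs, IsRun A c t) :
      IsRun A c (LTree.node (p, a :: γ) cs)

/-- An accepting run: a run from `(initial, ⊥)` to `(final, ⊥)`. -/
def IsAcceptingRun (A : APS Q Γ) (t : LTree (Q × List Γ)) : Prop :=
  t.label = (A.initial, [A.bot]) ∧ A.IsRun (A.final, [A.bot]) t

/-- The property to be decided: there is an accepting run with at most `k` leaves. -/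
def HasSparseRun (A : APS Q Γ) (k : ℕ) : Prop :=
  ∃ t, A.IsAcceptingRun t ∧ t.numLeaves ≤ k

/-- The size `|A|`: the number of states, plus the number of stack letters, plus the number of
occurrences of states and stack letters in the transitions. -/
def size [Fintype Q] [Fintype Γ] (A : APS Q Γ) : ℕ :=
  Fintype.card Q + Fintype.card Γ + ∑ t ∈ A.trans, (2 + ∑ u ∈ t.2.2, (1 + u.2.length))

end APS

/-! ### The model of computation

The WHILE language over binary trees (equivalently, a LISP machine): a program has finitely many
variables, each of which holds a binary tree (a pointer to a cons cell), and each elementary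
operation `nil`, `cons`, `hd`, `tl`, assignment and test for `nil` costs one time unit. -/

/-- The data: binary trees. -/
inductive Data where
  | nil : Data
  | cons (a b : Data) : Data

namespace Data

/-- The left subtree (`nil` for `nil`). -/
def hd : Data → Data
  | nil => nil
  | cons a _ => a

/-- The right subtree (`nil` for `nil`). -/
def tl : Data → Data
  | nil => nil
  | cons _ b => b

/-- The unary numeral `n`. -/
def ofNat : ℕ → Data
  | 0 => nil
  | n + 1 => cons nil (ofNat n)

/-- The list of the given data. -/
def ofList : List Data → Data
  | [] => nil
  | d :: ds => cons d (ofList ds)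

end Data

/-- A store assigns a tree to each variable. -/
abbrev Store := ℕ → Data

/-- Expressions; variables are numbered. -/
inductive Expr where
  | nil : Expr
  | var (x : ℕ) : Expr
  | cons (e f : Expr) : Expr
  | hd (e : Expr) : Expr
  | tl (e : Expr) : Expr

namespace Expr

def eval (s : Store) : Expr → Data
  | nil => Data.nil
  | var x => s x
  | cons e f => Data.cons (e.eval s) (f.eval s)
  | hd e => (e.eval s).hd
  | tl e => (e.eval s).tl

/-- The cost of evaluating an expression: the number of its operations and atoms. -/
def cost : Expr → ℕ
  | nil => 1
  | var _ => 1
  | cons e f => e.cost + f.cost + 1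
  | hd e => e.cost + 1
  | tl e => e.cost + 1

end Expr

/-- Programs: assignment, sequence, `if x ≠ nil then p else q`, and `while x ≠ nil do p`. -/
inductive Prog where
  | assign (x : ℕ) (e : Expr) : Prog
  | seq (p q : Prog) : Prog
  | ite (x : ℕ) (p q : Prog) : Prog
  | loop (x : ℕ) (p : Prog) : Prog

/-- `Exec p s s' n`: started in the store `s`, the program `p` halts in the store `s'` after `n`
time units. -/
inductive Exec : Prog → Store → Store → ℕ → Prop where
  | assign (x : ℕ) (e : Expr) (s : Store) :
      Exec (Prog.assign x e) s (Function.update s x (e.eval s)) (e.cost + 1)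
  | seq {p q : Prog} {s₁ s₂ s₃ : Store} {m n : ℕ} (hp : Exec p s₁ s₂ m) (hq : Exec q s₂ s₃ n) :
      Exec (Prog.seq p q) s₁ s₃ (m + n)
  | ite_then {x : ℕ} {p q : Prog} {s s' : Store} {n : ℕ} (hx : s x ≠ Data.nil)
      (hp : Exec p s s' n) : Exec (Prog.ite x p q) s s' (n + 1)
  | ite_else {x : ℕ} {p q : Prog} {s s' : Store} {n : ℕ} (hx : s x = Data.nil)
      (hq : Exec q s s' n) : Exec (Prog.ite x p q) s s' (n + 1)
  | loop_done {x : ℕ} {p : Prog} {s : Store} (hx : s x = Data.nil) : Exec (Prog.loop x p) s s 1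
  | loop_step {x : ℕ} {p : Prog} {s₁ s₂ s₃ : Store} {m n : ℕ} (hx : s₁ x ≠ Data.nil)
      (hp : Exec p s₁ s₂ m) (hl : Exec (Prog.loop x p) s₂ s₃ n) :
      Exec (Prog.loop x p) s₁ s₃ (m + n + 1)

/-- Execution is deterministic. -/
theorem Exec.deterministic {p : Prog} {s s₁ : Store} {n₁ : ℕ} (h₁ : Exec p s s₁ n₁) :
    ∀ {s₂ : Store} {n₂ : ℕ}, Exec p s s₂ n₂ → s₁ = s₂ ∧ n₁ = n₂ := by
  induction h₁ with
  | assign x e s =>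
    intro s₂ n₂ h
    cases h
    exact ⟨rfl, rfl⟩
  | seq _ _ ihp ihq =>
    intro s₂ n₂ h
    cases h with
    | seq hp hq =>
      obtain ⟨rfl, rfl⟩ := ihp hp
      obtain ⟨rfl, rfl⟩ := ihq hq
      exact ⟨rfl, rfl⟩
  | ite_then hx _ ih =>
    intro s₂ n₂ h
    cases h with
    | ite_then _ hp =>
      obtain ⟨rfl, rfl⟩ := ih hp
      exact ⟨rfl, rfl⟩
    | ite_else hx' _ => exact absurd hx' hx
  | ite_else hx _ ih =>
    intro s₂ n₂ h
    cases h with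
    | ite_then hx' _ => exact absurd hx hx'
    | ite_else _ hq =>
      obtain ⟨rfl, rfl⟩ := ih hq
      exact ⟨rfl, rfl⟩
  | loop_done hx =>
    intro s₂ n₂ h
    cases h with
    | loop_done _ => exact ⟨rfl, rfl⟩
    | loop_step hx' _ _ => exact absurd hx hx'
  | loop_step hx _ _ ihp ihl =>
    intro s₂ n₂ h
    cases h with
    | loop_done hx' => exact absurd hx' hx
    | loop_step _ hp hl =>
      obtain ⟨rfl, rfl⟩ := ihp hp
      obtain ⟨rfl, rfl⟩ := ihl hl
      exact ⟨rfl, rfl⟩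

/-- `Computes p d d' n`: on input `d` the program `p` halts after `n` time units with output `d'`.
Input and output are in variable `0`; all other variables are initially `nil`. -/
def Computes (p : Prog) (d d' : Data) (n : ℕ) : Prop :=
  ∃ s', Exec p (Function.update (fun _ => Data.nil) 0 d) s' n ∧ s' 0 = d'

/-! ### Encoding of instances

States and stack letters are numbered and written in unary; finite sets are written as lists of
their elements, without repetition and in an arbitrary order. -/

/-- `d` is a list of encodings of the elements of the finite set `S`, each occurring once, where
`R a e` says that `e` encodes `a`. -/
def EncodesSet {α : Type*} (R : α → Data → Prop) (S : Finset α) (d : Data) : Prop :=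
  ∃ (l : List α) (es : List Data), l.Nodup ∧ (∀ a, a ∈ l ↔ a ∈ S) ∧ List.Forall₂ R l es ∧
    d = Data.ofList es

section

variable {Q Γ : Type*}

/-- `d` encodes the pair (state, word) with respect to the given numberings. -/
def EncodesTarget (νQ : Q → ℕ) (νΓ : Γ → ℕ) (u : Q × List Γ) (d : Data) : Prop :=
  d = Data.cons (Data.ofNat (νQ u.1)) (Data.ofList (u.2.map fun a => Data.ofNat (νΓ a)))

/-- `d` encodes the transition `t` with respect to the given numberings. -/
def EncodesTrans (νQ : Q → ℕ) (νΓ : Γ → ℕ) (t : Q × Γ × Finset (Q × List Γ)) (d : Data) : Prop :=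
  ∃ e, EncodesSet (EncodesTarget νQ νΓ) t.2.2 e ∧
    d = Data.cons (Data.ofNat (νQ t.1)) (Data.cons (Data.ofNat (νΓ t.2.1)) e)

/-- `d` encodes the instance `(A, k)`: it is the list consisting of `k`, `|Q|`, `|Γ|`, the initial
state, the final state, the letter `⊥`, and a list of the transitions, for some numbering of `Q` by
`0, …, |Q| - 1` and of `Γ` by `0, …, |Γ| - 1`. All numbers, in particular `k`, are in unary. -/
def EncodesInstance [Fintype Q] [Fintype Γ] (A : APS Q Γ) (k : ℕ) (d : Data) : Prop :=
  ∃ (νQ : Q ≃ Fin (Fintype.card Q)) (νΓ : Γ ≃ Fin (Fintype.card Γ)) (e : Data),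
    EncodesSet (EncodesTrans (fun q => (νQ q : ℕ)) (fun a => (νΓ a : ℕ))) A.trans e ∧
      d = Data.ofList [Data.ofNat k, Data.ofNat (Fintype.card Q), Data.ofNat (Fintype.card Γ),
        Data.ofNat (νQ A.initial), Data.ofNat (νQ A.final), Data.ofNat (νΓ A.bot), e]

end

end SparseEmpty

/-! An accepting run is cut wherever a stack letter is popped. Call a triple (q, a, M), with M a
list of states, derivable if, starting in q with a on top, every branch can pop a, the branches
arriving in the states M from left to right. A transition (q, a) ↪ T yields such triples: the word
pushed by each target is popped letter by letter, and the resulting lists are concatenated over T.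
To treat acceptance as a pop, there is an extra state, `endState`, reached by popping ⊥ in the final
state; nothing can be popped from it. Then there is an accepting run with n leaves exactly when
(init, ⊥, M) is derivable for the list M consisting of n copies of `endState`.

The leaf bound makes the search finite. Only nonempty lists M are admitted, so a pop never shortens
a list of states (`WordPop.length_le`). All lists that occur on the way to a list of length at most
k therefore have length at most k as well, and the least fixed point may be computed inside the
triples whose list belongs to the set U of words of length at most k. Soundness is `pops_isSound`,
which turns derivable triples into run fragments with an exact count of leaves. Completeness is
`wordPop_of_isRun`, by induction on the run. They are combined in `accepts_iff`.

For the running time, the fixed point is polynomial in the sizes of the instance d and of U. This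
follows from closure properties of polynomial-time functions (`Poly`), in particular bounded loops
and folds. As U has size |d|^O(k), the total time is |d|^O(k) (`exists_prog`). Since k is unary and
not bounded by |A|, the available estimate is |d| ≤ |A|^(8k) (`EncodesInstance.sz_le`), whence the
exponent of order k². -/

namespace SparseEmpty

/-! ### Renaming of variables -/

/-- Renaming of the variables of an expression. -/
def Expr.rename (σ : ℕ → ℕ) : Expr → Expr
  | nil => nil
  | var x => var (σ x)
  | cons e f => cons (e.rename σ) (f.rename σ)
  | hd e => hd (e.rename σ)
  | tl e => tl (e.rename σ)

/-- Renaming of the variables of a program. -/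
def Prog.rename (σ : ℕ → ℕ) : Prog → Prog
  | assign x e => assign (σ x) (e.rename σ)
  | seq p q => seq (p.rename σ) (q.rename σ)
  | ite x p q => ite (σ x) (p.rename σ) (q.rename σ)
  | loop x p => loop (σ x) (p.rename σ)

theorem Expr.eval_rename (σ : ℕ → ℕ) (s : Store) (e : Expr) :
    (e.rename σ).eval s = e.eval (s ∘ σ) := by
  induction e <;> simp_all [Expr.rename, Expr.eval]

theorem Expr.cost_rename (σ : ℕ → ℕ) (e : Expr) : (e.rename σ).cost = e.cost := by
  induction e <;> simp_all [Expr.rename, Expr.cost]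

/-- A renamed program behaves like the program, and leaves the other variables unchanged. -/
theorem Exec.rename {σ : ℕ → ℕ} (hσ : Function.Injective σ) {p : Prog} {s s' : Store} {n : ℕ}
    (h : Exec p s s' n) : ∀ r : Store, r ∘ σ = s →
      ∃ r', Exec (p.rename σ) r r' n ∧ r' ∘ σ = s' ∧ ∀ x, x ∉ Set.range σ → r' x = r x := by
  induction h with
  | assign x e s =>
    rintro r rfl
    refine ⟨_, Expr.cost_rename σ e ▸ Exec.assign _ _ _, ?_, ?_⟩
    · rw [Expr.eval_rename]
      exact Function.update_comp_eq_of_injective _ hσ _ _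
    · intro y hy
      exact Function.update_of_ne (fun h => hy ⟨x, h.symm⟩) _ _
  | seq _ _ ihp ihq =>
    intro r hr
    obtain ⟨r₁, h₁, e₁, f₁⟩ := ihp r hr
    obtain ⟨r₂, h₂, e₂, f₂⟩ := ihq r₁ e₁
    exact ⟨r₂, .seq h₁ h₂, e₂, fun x hx => (f₂ x hx).trans (f₁ x hx)⟩
  | ite_then hx _ ih =>
    rintro r rfl
    obtain ⟨r₁, h₁, e₁, f₁⟩ := ih r rfl
    exact ⟨r₁, .ite_then hx h₁, e₁, f₁⟩
  | ite_else hx _ ih =>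
    rintro r rfl
    obtain ⟨r₁, h₁, e₁, f₁⟩ := ih r rfl
    exact ⟨r₁, .ite_else hx h₁, e₁, f₁⟩
  | loop_done hx =>
    rintro r rfl
    exact ⟨r, .loop_done hx, rfl, fun _ _ => rfl⟩
  | loop_step hx _ _ ihp ihl =>
    rintro r rfl
    obtain ⟨r₁, h₁, e₁, f₁⟩ := ihp r rfl
    obtain ⟨r₂, h₂, e₂, f₂⟩ := ihl r₁ e₁
    exact ⟨r₂, .loop_step hx h₁ h₂, e₂, fun x hx => (f₂ x hx).trans (f₁ x hx)⟩

/-! ### Functions computable in polynomial time -/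

/-- Twice the number of leaves of a tree. -/
def Data.sz : Data → ℕ
  | nil => 2
  | cons a b => a.sz + b.sz

theorem Data.two_le_sz (d : Data) : 2 ≤ d.sz := by
  induction d with
  | nil => simp [sz]
  | cons a b _ _ => simp only [sz]; omega

theorem Data.sz_hd_le (d : Data) : d.hd.sz ≤ d.sz := by
  cases d <;> simp [sz, hd]

theorem Data.sz_tl_le (d : Data) : d.tl.sz ≤ d.sz := by
  cases d <;> simp [sz, tl]

/-- The program `p` computes `f`, with input and output in variable `0`, in time `t`. The initial
values of the other variables do not matter. -/
def Realizes (p : Prog) (f : Data → Data) (t : Data → ℕ) : Prop :=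
  ∀ s : Store, ∃ s' n, Exec p s s' n ∧ s' 0 = f (s 0) ∧ n ≤ t (s 0)

/-- `f` is computed by a program in polynomial time, and the size of its values is polynomially
bounded. -/
def Poly (f : Data → Data) : Prop :=
  ∃ p c, Realizes p f (fun d => d.sz ^ c) ∧ ∀ d, (f d).sz ≤ d.sz ^ c

theorem Realizes.mono {p : Prog} {f : Data → Data} {t t' : Data → ℕ} (h : Realizes p f t)
    (ht : ∀ d, t d ≤ t' d) : Realizes p f t' := fun s =>
  let ⟨s', n, h₁, h₂, h₃⟩ := h s
  ⟨s', n, h₁, h₂, h₃.trans (ht _)⟩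

theorem pow_sz_mono (d : Data) {a b : ℕ} (h : a ≤ b) : d.sz ^ a ≤ d.sz ^ b :=
  Nat.pow_le_pow_right (by have := d.two_le_sz; omega) h

theorem const_le_pow_sz (d : Data) (a : ℕ) : a ≤ d.sz ^ a :=
  (Nat.lt_two_pow_self).le.trans (Nat.pow_le_pow_left d.two_le_sz a)

/-- One spare factor `x ≥ 2` absorbs the sum. This is the reason for counting every leaf twice in
`Data.sz`: the base is then never 1. -/
theorem add_le_pow {x a b m n : ℕ} (hx : 2 ≤ x) (ha : a ≤ x ^ m) (hb : b ≤ x ^ n) :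
    a + b ≤ x ^ (m + n + 1) := by
  have h1 : x ^ m ≤ x ^ (m + n) := Nat.pow_le_pow_right (by omega) (by omega)
  have h2 : x ^ n ≤ x ^ (m + n) := Nat.pow_le_pow_right (by omega) (by omega)
  calc a + b ≤ x ^ (m + n) * 2 := by omega
    _ ≤ x ^ (m + n) * x := Nat.mul_le_mul_left _ hx
    _ = _ := (pow_succ _ _).symm

theorem mul_le_pow {x a b m n : ℕ} (ha : a ≤ x ^ m) (hb : b ≤ x ^ n) :
    a * b ≤ x ^ (m + n) := by
  rw [pow_add]; exact Nat.mul_le_mul ha hb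

/-- A function is polynomially bounded in the size of its argument. -/
def PBound (t : Data → ℕ) : Prop := ∃ c, ∀ d, t d ≤ d.sz ^ c

theorem PBound.const (a : ℕ) : PBound fun _ => a := ⟨a, fun d => const_le_pow_sz d a⟩

theorem PBound.sz : PBound Data.sz := ⟨1, fun d => by simp⟩

theorem PBound.add {t u : Data → ℕ} (ht : PBound t) (hu : PBound u) :
    PBound fun d => t d + u d := by
  obtain ⟨a, ha⟩ := ht
  obtain ⟨b, hb⟩ := hu
  exact ⟨_, fun d => add_le_pow d.two_le_sz (ha d) (hb d)⟩

theorem PBound.mul {t u : Data → ℕ} (ht : PBound t) (hu : PBound u) :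
    PBound fun d => t d * u d := by
  obtain ⟨a, ha⟩ := ht
  obtain ⟨b, hb⟩ := hu
  exact ⟨_, fun d => mul_le_pow (ha d) (hb d)⟩

theorem PBound.pow {t : Data → ℕ} (ht : PBound t) (c : ℕ) : PBound fun d => t d ^ c := by
  obtain ⟨a, ha⟩ := ht
  exact ⟨a * c, fun d => by rw [pow_mul]; exact Nat.pow_le_pow_left (ha d) c⟩

theorem PBound.mono {t u : Data → ℕ} (ht : PBound t) (h : ∀ d, u d ≤ t d) : PBound u :=
  let ⟨c, hc⟩ := ht
  ⟨c, fun d => (h d).trans (hc d)⟩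

theorem Poly.sz {f : Data → Data} (hf : Poly f) : PBound fun d => (f d).sz :=
  let ⟨_, c, _, h⟩ := hf
  ⟨c, h⟩

theorem Poly.exists_realizes {f : Data → Data} (hf : Poly f) :
    ∃ p t, PBound t ∧ Realizes p f t :=
  let ⟨p, c, h, _⟩ := hf
  ⟨p, _, ⟨c, fun _ => le_rfl⟩, h⟩

theorem Poly.of_realizes {p : Prog} {f : Data → Data} {t : Data → ℕ} (h : Realizes p f t)
    (ht : PBound t) (hs : PBound fun d => (f d).sz) : Poly f := by
  obtain ⟨a, ha⟩ := ht
  obtain ⟨b, hb⟩ := hs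
  exact ⟨p, a + b, h.mono fun d => (ha d).trans (pow_sz_mono d (by omega)),
    fun d => (hb d).trans (pow_sz_mono d (by omega))⟩

theorem Realizes.assign (e : Expr) (f : Data → Data) (h : ∀ s, e.eval s = f (s 0)) :
    Realizes (.assign 0 e) f fun _ => e.cost + 1 := fun s =>
  ⟨_, _, .assign 0 e s, by simp [h], le_rfl⟩

theorem Poly.id : Poly fun d => d :=
  .of_realizes (.assign (.var 0) _ fun _ => rfl) (.const _) .sz

theorem Poly.nil : Poly fun _ => Data.nil :=
  .of_realizes (.assign .nil _ fun _ => rfl) (.const _) (.const _)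

theorem Realizes.comp {p q : Prog} {f g : Data → Data} {t u : Data → ℕ} (hf : Realizes p f t)
    (hg : Realizes q g u) : Realizes (.seq q p) (fun d => f (g d)) fun d => u d + t (g d) := by
  intro s
  obtain ⟨s₁, m, h₁, e₁, b₁⟩ := hg s
  obtain ⟨s₂, n, h₂, e₂, b₂⟩ := hf s₁
  rw [e₁] at e₂ b₂
  exact ⟨s₂, _, .seq h₁ h₂, e₂, Nat.add_le_add b₁ b₂⟩

theorem PBound.comp {t : Data → ℕ} {g : Data → Data} (ht : PBound t) (hg : Poly g) :
    PBound fun d => t (g d) := by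
  obtain ⟨a, ha⟩ := ht
  exact (hg.sz.pow a).mono fun d => ha _

/-- The size clause of `Poly` is indispensable here: the outer running time depends on the size of
the inner value, which the inner running time alone does not control polynomially, because `cons x
x` doubles a tree at constant cost. -/
theorem Poly.comp {f g : Data → Data} (hf : Poly f) (hg : Poly g) : Poly fun d => f (g d) := by
  obtain ⟨p, t, ht, hp⟩ := hf.exists_realizes
  obtain ⟨q, u, hu, hq⟩ := hg.exists_realizes
  exact .of_realizes (hp.comp hq) (hu.add (ht.comp hg)) (hf.sz.comp hg)

theorem Poly.hd {f : Data → Data} (hf : Poly f) : Poly fun d => (f d).hd :=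
  Poly.comp (f := Data.hd) (.of_realizes (.assign (.hd (.var 0)) _ fun _ => rfl) (.const _)
    (PBound.sz.mono Data.sz_hd_le)) hf

theorem Poly.tl {f : Data → Data} (hf : Poly f) : Poly fun d => (f d).tl :=
  Poly.comp (f := Data.tl) (.of_realizes (.assign (.tl (.var 0)) _ fun _ => rfl) (.const _)
    (PBound.sz.mono Data.sz_tl_le)) hf

/-- A program that runs `p` on (a copy of) the input, with the result in variable `1`, and does not
change the even variables. -/
theorem Realizes.exists_aux {p : Prog} {f : Data → Data} {t : Data → ℕ} (hf : Realizes p f t)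
    (i : ℕ) (s : Store) :
    ∃ s' n, Exec (.seq (.assign (i + 1) (.var 0)) (p.rename fun x => 2 * x + (i + 1))) s s' n ∧
      s' (i + 1) = f (s 0) ∧ s' 0 = s 0 ∧ n ≤ t (s 0) + 2 ∧ (i = 1 → s' 1 = s 1) := by
  have hinj : Function.Injective fun x => 2 * x + (i + 1) := fun x y h => by simp at h; exact h
  set s₁ : Store := Function.update s (i + 1) (s 0)
  obtain ⟨s₂, n, h₂, e₂, b₂⟩ := hf (s₁ ∘ fun x => 2 * x + (i + 1))
  obtain ⟨r, hr, er, fr⟩ := h₂.rename hinj s₁ rfl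
  have h0 : (s₁ ∘ fun x => 2 * x + (i + 1)) 0 = s 0 := by simp [s₁]
  rw [h0] at e₂ b₂
  refine ⟨r, _, .seq (.assign _ _ _) hr, ?_, ?_, ?_, ?_⟩
  · rw [← e₂, ← er]; simp
  · rw [fr 0 (by rintro ⟨x, hx⟩; simp at hx)]
    simp [s₁]
  · simp only [Expr.cost]; omega
  · rintro rfl
    rw [fr 1 (by rintro ⟨x, hx⟩; simp at hx)]
    simp [s₁]

/-- The first program works on the odd variables and the second on the even ones from 2 on, so the
input in variable 0 and the first result in variable 1 survive. -/
theorem Poly.cons {f g : Data → Data} (hf : Poly f) (hg : Poly g) :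
    Poly fun d => Data.cons (f d) (g d) := by
  obtain ⟨p, t, ht, hp⟩ := hf.exists_realizes
  obtain ⟨q, u, hu, hq⟩ := hg.exists_realizes
  refine .of_realizes (p := .seq (.seq (.seq (.assign 1 (.var 0)) (p.rename fun x => 2 * x + 1))
    (.seq (.assign 2 (.var 0)) (q.rename fun x => 2 * x + 2)))
    (.assign 0 (.cons (.var 1) (.var 2))))
    (t := fun d => (t d + 2) + (u d + 2) + 4) ?_
    (((ht.add (.const _)).add (hu.add (.const _))).add (.const _)) (hf.sz.add hg.sz)
  intro s
  obtain ⟨s₁, m, h₁, e₁, f₁, b₁, -⟩ := hp.exists_aux 0 s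
  obtain ⟨s₂, n, h₂, e₂, f₂, b₂, k₂⟩ := hq.exists_aux 1 s₁
  refine ⟨_, _, .seq (.seq h₁ h₂) (.assign _ _ _), ?_, ?_⟩
  · have := k₂ rfl
    simp only [Expr.eval, Function.update_self]
    simp_all
  · rw [f₁] at b₂
    simp only [Expr.cost]; omega

/-- Case distinction with respect to an arbitrary proposition. -/
noncomputable def Data.cond (p : Prop) (a b : Data) : Data := open Classical in if p then a else b

@[simp] theorem Data.cond_pos {p : Prop} (h : p) (a b : Data) : cond p a b = a := if_pos h

@[simp] theorem Data.cond_neg {p : Prop} (h : ¬ p) (a b : Data) : cond p a b = b := if_neg h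

theorem Poly.ite {f g h : Data → Data} (hf : Poly f) (hg : Poly g) (hh : Poly h) :
    Poly fun d => Data.cond (f d ≠ Data.nil) (g d) (h d) := by
  obtain ⟨p, t, ht, hp⟩ := hf.exists_realizes
  obtain ⟨q, u, hu, hq⟩ := hg.exists_realizes
  obtain ⟨r, v, hv, hr⟩ := hh.exists_realizes
  refine .of_realizes (p := .seq (.seq (.assign 1 (.var 0)) (p.rename fun x => 2 * x + 1))
    (.ite 1 q r)) (t := fun d => (t d + 2) + (u d + v d) + 1) ?_
    (((ht.add (.const _)).add (hu.add hv)).add (.const _)) ((hg.sz.add hh.sz).mono fun d => ?_)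
  · intro s
    obtain ⟨s₁, m, h₁, e₁, f₁, b₁, -⟩ := hp.exists_aux 0 s
    obtain ⟨s₂, n, h₂, e₂, b₂⟩ := hq s₁
    obtain ⟨s₃, n', h₃, e₃, b₃⟩ := hr s₁
    rw [f₁] at e₂ b₂ e₃ b₃
    by_cases hc : f (s 0) = Data.nil
    · exact ⟨s₃, _, .seq h₁ (.ite_else (by rwa [← e₁] at hc) h₃), by simp [hc, e₃],
        by dsimp only; omega⟩
    · exact ⟨s₂, _, .seq h₁ (.ite_then (by rwa [← e₁] at hc) h₂), by simp [hc, e₂],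
        by dsimp only; omega⟩
  · by_cases hc : f d = Data.nil <;> simp [hc]

/-! ### Loops with an invariant and a decreasing measure -/

/-- The loop that runs `p` as long as the first component of variable `0` is not `nil`. -/
def Prog.whileHd (p : Prog) : Prog :=
  .seq (.assign 1 (.hd (.var 0))) (.loop 1 (.seq p (.assign 1 (.hd (.var 0)))))

theorem Exec.whileHd {p : Prog} {g : Data → Data} {t : Data → ℕ} (hg : Realizes p g t)
    (I : Data → Prop) (μ : Data → ℕ) (T : ℕ)
    (hI : ∀ x, I x → x.hd ≠ Data.nil → I (g x) ∧ μ (g x) < μ x ∧ t x ≤ T) (s : Store)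
    (hs : I (s 0)) : ∃ s' n, Exec p.whileHd s s' n ∧ I (s' 0) ∧ (s' 0).hd = Data.nil ∧
      n ≤ μ (s 0) * (T + 4) + 4 := by
  have key : ∀ m (s : Store), μ (s 0) ≤ m → I (s 0) → s 1 = (s 0).hd →
      ∃ s' n, Exec (.loop 1 (.seq p (.assign 1 (.hd (.var 0))))) s s' n ∧ I (s' 0) ∧
        (s' 0).hd = Data.nil ∧ n ≤ m * (T + 4) + 1 := by
    intro m
    induction m with
    | zero =>
      intro s hm hs h1
      by_cases hn : s 1 = Data.nil
      · exact ⟨s, 1, .loop_done hn, hs, h1 ▸ hn, by simp⟩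
      · have := (hI _ hs (h1 ▸ hn)).2.1
        omega
    | succ m ih =>
      intro s hm hs h1
      by_cases hn : s 1 = Data.nil
      · exact ⟨s, 1, .loop_done hn, hs, h1 ▸ hn, by simp⟩
      · obtain ⟨a, b, c⟩ := hI _ hs (h1 ▸ hn)
        obtain ⟨s₁, n₁, h₁, e₁, b₁⟩ := hg s
        set s₂ : Store := Function.update s₁ 1 (s₁ 0).hd
        have e₂ : s₂ 0 = g (s 0) := by simp [s₂, e₁]
        obtain ⟨s₃, n₃, h₃, i₃, e₃, b₃⟩ := ih s₂ (by rw [e₂]; omega) (e₂ ▸ a) (by simp [s₂])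
        refine ⟨s₃, _, .loop_step hn (.seq h₁ (.assign _ _ _)) h₃, i₃, e₃, ?_⟩
        simp only [Expr.cost]
        have : (m + 1) * (T + 4) = m * (T + 4) + (T + 4) := by ring
        omega
  set s₁ : Store := Function.update s 1 (s 0).hd
  have e₁ : s₁ 0 = s 0 := by simp [s₁]
  obtain ⟨s₂, n₂, h₂, i₂, e₂, b₂⟩ := key _ s₁ le_rfl (e₁ ▸ hs) (by simp [s₁])
  refine ⟨s₂, _, .seq (.assign _ _ _) h₂, i₂, e₂, ?_⟩
  rw [e₁] at b₂
  simp only [Expr.cost]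
  omega

/-- The invariant `I d` keeps all intermediate states within size `b d`, so each round costs a
polynomial in the size of the input, and `μ` bounds the number of rounds. -/
theorem Poly.whileHd {g F post : Data → Data} (hg : Poly g) (hpost : Poly post)
    (I : Data → Data → Prop) (μ : Data → ℕ)
    (b : Data → ℕ) (hb : PBound b) (hI₀ : ∀ d, I d d)
    (hI : ∀ d x, I d x → x.hd ≠ Data.nil → I d (g x) ∧ μ (g x) < μ x)
    (hsz : ∀ d x, I d x → x.sz ≤ b d) (hμ : PBound μ)
    (hF : ∀ d x, I d x → x.hd = Data.nil → post x = F d) : Poly F := by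
  obtain ⟨p, c, hp, -⟩ := hg
  have H : ∀ s : Store, ∃ s' n, Exec p.whileHd s s' n ∧ I (s 0) (s' 0) ∧ (s' 0).hd = Data.nil ∧
      n ≤ μ (s 0) * (b (s 0) ^ c + 4) + 4 := fun s =>
    Exec.whileHd hp (I (s 0)) μ (b (s 0) ^ c) (fun x hx hn => ⟨(hI _ x hx hn).1, (hI _ x hx hn).2,
      Nat.pow_le_pow_left (hsz _ x hx) c⟩) s (hI₀ _)
  obtain ⟨q, e, hq, hqs⟩ := hpost
  refine .of_realizes (p := .seq p.whileHd q)
    (t := fun d => (μ d * (b d ^ c + 4) + 4) + b d ^ e) ?_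
    (((hμ.mul ((hb.pow c).add (.const _))).add (.const _)).add (hb.pow e))
    ((hb.pow e).mono fun d => ?_)
  · intro s
    obtain ⟨s', n, h, i, e', bd⟩ := H s
    obtain ⟨s'', n', h', e'', bd'⟩ := hq s'
    exact ⟨s'', _, .seq h h', e''.trans (hF _ _ i e'), Nat.add_le_add bd
      (bd'.trans (Nat.pow_le_pow_left (hsz _ _ i) e))⟩
  -- The size of `F d` is read off from an actual execution, whose last state satisfies the
  -- invariant.
  · obtain ⟨s', n, h, i, e', -⟩ := H (fun _ => d)
    rw [← hF _ _ i e']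
    exact (hqs _).trans (Nat.pow_le_pow_left (hsz _ _ i) e)

/-! ### Trees as lists -/

/-- Every tree is a list of trees. -/
def Data.toList : Data → List Data
  | nil => []
  | cons a b => a :: b.toList

@[simp] theorem Data.toList_nil : Data.nil.toList = [] := rfl

@[simp] theorem Data.toList_cons (a b : Data) : (Data.cons a b).toList = a :: b.toList := rfl

@[simp] theorem Data.hd_cons (a b : Data) : (Data.cons a b).hd = a := rfl

@[simp] theorem Data.tl_cons (a b : Data) : (Data.cons a b).tl = b := rfl

@[simp] theorem Data.toList_ofList (l : List Data) : (Data.ofList l).toList = l := by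
  induction l <;> simp_all [Data.ofList]

@[simp] theorem Data.ofList_toList (d : Data) : Data.ofList d.toList = d := by
  induction d <;> simp_all [Data.ofList]

theorem Data.sz_le (d : Data) : d.sz ≤ d.hd.sz + d.tl.sz := by
  cases d <;> simp [sz, hd, tl]

theorem Data.toList_of_ne {d : Data} (h : d ≠ nil) : d.toList = d.hd :: d.tl.toList := by
  cases d with
  | nil => exact absurd rfl h
  | cons a b => rfl

theorem Data.toList_ne_nil {d : Data} : d.toList ≠ [] ↔ d ≠ nil := by
  cases d <;> simp

theorem Data.sz_ofList (l : List Data) : (ofList l).sz = (l.map sz).sum + 2 := by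
  induction l with
  | nil => rfl
  | cons a l ih => simp only [ofList, sz, ih, List.map_cons, List.sum_cons]; omega

theorem Data.sz_eq_sum (d : Data) : d.sz = (d.toList.map sz).sum + 2 := by
  rw [← sz_ofList, ofList_toList]

theorem Data.length_toList_lt (d : Data) : d.toList.length < d.sz := by
  induction d with
  | nil => simp [sz]
  | cons a b _ ih => have := a.two_le_sz; simp only [toList_cons, List.length_cons, sz]; omega

/-! ### Polynomial-time predicates -/

/-- The truth values `nil` and `cons nil nil`. -/
noncomputable def Data.bool (p : Prop) : Data := cond p (cons nil nil) nil

theorem Data.bool_ne_nil {p : Prop} : bool p ≠ nil ↔ p := by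
  by_cases h : p <;> simp [bool, h]

theorem Poly.const (a : Data) : Poly fun _ => a := by
  induction a with
  | nil => exact .nil
  | cons a b iha ihb => exact iha.cons ihb

/-- `P` can be decided in polynomial time. -/
def PolyDec (P : Data → Prop) : Prop := Poly fun d => Data.bool (P d)

theorem PolyDec.ite {P : Data → Prop} {g h : Data → Data} (hP : PolyDec P) (hg : Poly g)
    (hh : Poly h) : Poly fun d => Data.cond (P d) (g d) (h d) := by
  have := Poly.ite hP hg hh
  simpa only [Data.bool_ne_nil] using this

theorem PolyDec.ne_nil {f : Data → Data} (hf : Poly f) : PolyDec fun d => f d ≠ Data.nil :=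
  Poly.ite hf (.const (.cons .nil .nil)) .nil

theorem PolyDec.not {P : Data → Prop} (hP : PolyDec P) : PolyDec fun d => ¬ P d := by
  have := hP.ite .nil (.const (.cons .nil .nil))
  unfold PolyDec
  convert this using 2 with d
  by_cases h : P d <;> simp [h, Data.bool]

theorem PolyDec.and {P Q : Data → Prop} (hP : PolyDec P) (hQ : PolyDec Q) :
    PolyDec fun d => P d ∧ Q d := by
  have := hP.ite hQ .nil
  unfold PolyDec
  convert this using 2 with d
  by_cases h : P d <;> simp [h, Data.bool]

theorem PolyDec.or {P Q : Data → Prop} (hP : PolyDec P) (hQ : PolyDec Q) :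
    PolyDec fun d => P d ∨ Q d := by
  have := (hP.not.and hQ.not).not
  simpa only [not_and_or, not_not] using this

/-- Equality of trees: `x.hd` is a list of pairs of trees that remain to be compared. -/
noncomputable def Data.eqStep (x : Data) : Data :=
  cond (x.hd.hd.hd ≠ nil)
    (cond (x.hd.hd.tl ≠ nil)
      (cons (cons (cons x.hd.hd.hd.hd x.hd.hd.tl.hd)
        (cons (cons x.hd.hd.hd.tl x.hd.hd.tl.tl) x.hd.tl)) x.tl)
      (cons nil nil))
    (cond (x.hd.hd.tl ≠ nil) (cons nil nil) (cons x.hd.tl x.tl))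

theorem Poly.eqStep : Poly Data.eqStep := by
  have a : Poly fun x => x.hd.hd.hd := Poly.id.hd.hd.hd
  have b : Poly fun x => x.hd.hd.tl := Poly.id.hd.hd.tl
  exact .ite a (.ite b (.cons (.cons (a.hd.cons b.hd) (.cons (a.tl.cons b.tl) Poly.id.hd.tl))
    Poly.id.tl) (.const (.cons .nil .nil))) (.ite b (.const (.cons .nil .nil))
    (.cons Poly.id.hd.tl Poly.id.tl))

theorem Poly.eqLoop :
    Poly fun d => Data.cond (∀ p ∈ d.hd.toList, p.hd = p.tl) d.tl Data.nil := by
  -- Splitting a pair of nodes preserves the total size but lowers the measure, since each pair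
  -- contributes its left size minus one. A mismatch resets the state to `cons nil nil`, of size 4,
  -- which ends the loop with result `nil`.
  refine .whileHd .eqStep Poly.id.tl (fun d x => x.sz ≤ d.sz + 4 ∧
    Data.cond (∀ p ∈ x.hd.toList, p.hd = p.tl) x.tl .nil =
      Data.cond (∀ p ∈ d.hd.toList, p.hd = p.tl) d.tl .nil)
    (fun x => (x.hd.toList.map fun p => p.hd.sz - 1).sum) (fun d => d.sz + 4)
    (PBound.sz.add (.const 4)) (fun d => ⟨by omega, rfl⟩) ?_ (fun d x h => h.1)
    (PBound.sz.mono fun d => ?_) ?_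
  · rintro d x ⟨hsz, heq⟩ hx
    rw [← heq]
    obtain ⟨wl, r, rfl⟩ : ∃ wl r, x = Data.cons wl r := by
      cases x with
      | nil => exact absurd rfl hx
      | cons a b => exact ⟨_, _, rfl⟩
    obtain ⟨p, rest, rfl⟩ : ∃ a b, wl = Data.cons a b := by
      cases wl with
      | nil => exact absurd rfl hx
      | cons a b => exact ⟨_, _, rfl⟩
    have hd2 := d.two_le_sz
    clear heq hx
    rcases p with _ | ⟨_ | ⟨a1, a2⟩, _ | ⟨b1, b2⟩⟩ <;>
      simp [Data.eqStep, Data.sz, Data.hd, Data.tl] at hsz ⊢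
    · omega
    · omega
    · have := a1.two_le_sz
      omega
    · have := a1.two_le_sz
      have := a2.two_le_sz
      refine ⟨⟨by omega, ?_⟩, by omega⟩
      simp only [and_assoc]
  · refine le_trans ?_ d.sz_hd_le
    generalize d.hd = l
    induction l with
    | nil => simp
    | cons a b _ ih =>
      have := a.sz_hd_le
      simp only [Data.toList_cons, List.map_cons, List.sum_cons, Data.sz]
      omega
  · rintro d x ⟨-, h⟩ hx
    simpa [hx] using h

theorem PolyDec.eq {f g : Data → Data} (hf : Poly f) (hg : Poly g) :
    PolyDec fun d => f d = g d := by
  have := Poly.eqLoop.comp (((hf.cons hg).cons .nil).cons (.const (.cons .nil .nil)))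
  simpa [PolyDec, Data.bool] using this

/-! ### Iteration over lists -/

/-- The growth per step is additive, with a bound independent of the accumulator. Growth merely
polynomial in the accumulator could compound to an exponential over the list. -/
theorem Poly.foldl {L a : Data → Data} {g : Data → Data → Data → Data} (hL : Poly L) (ha : Poly a)
    (hg : Poly fun e => g e.hd e.tl.hd e.tl.tl) {b : Data → ℕ} (hb : PBound b)
    (hgb : ∀ d x acc, (g d x acc).sz ≤ acc.sz + b (.cons d x)) :
    Poly fun d => (L d).toList.foldl (fun acc x => g d x acc) (a d) := by
  obtain ⟨c, hc⟩ := hb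
  refine Poly.comp (f := fun s => s.hd.toList.foldl (fun acc x => g s.tl.hd x acc) s.tl.tl)
    (g := fun d => .cons (L d) (.cons d (a d))) ?_ (hL.cons (Poly.id.cons ha))
  refine .whileHd (g := fun x => .cons x.hd.tl (.cons x.tl.hd (g x.tl.hd x.hd.hd x.tl.tl)))
    (post := fun x => x.tl.tl) ?_ Poly.id.tl.tl
    (fun s x => x.tl.hd = s.tl.hd ∧ x.hd.toList.foldl (fun acc x => g s.tl.hd x acc) x.tl.tl =
      s.hd.toList.foldl (fun acc x => g s.tl.hd x acc) s.tl.tl ∧ x.hd.sz ≤ s.hd.sz ∧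
      x.tl.tl.sz + x.hd.toList.length * (2 * s.sz) ^ c ≤
        s.tl.tl.sz + s.hd.toList.length * (2 * s.sz) ^ c)
    (fun x => x.hd.toList.length) (fun s => s.sz + (s.sz + (s.sz + s.sz * (2 * s.sz) ^ c)))
    ?_ (fun d => ⟨rfl, rfl, le_rfl, le_rfl⟩) ?_ ?_ ?_ ?_
  · exact Poly.id.hd.tl.cons (Poly.id.tl.hd.cons
      (hg.comp (Poly.id.tl.hd.cons (Poly.id.hd.hd.cons Poly.id.tl.tl))))
  · exact PBound.sz.add (PBound.sz.add (PBound.sz.add (PBound.sz.mul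
      (((PBound.const 2).mul PBound.sz).pow c))))
  · rintro s x ⟨h1, h2, h3, h4⟩ hx
    have e := Data.toList_of_ne hx
    simp only [Data.hd_cons, Data.tl_cons]
    refine ⟨⟨h1, ?_, x.hd.sz_tl_le.trans h3, ?_⟩, ?_⟩
    · rw [← h2, e, h1]; rfl
    · rw [e] at h4
      have h5 := hgb x.tl.hd x.hd.hd x.tl.tl
      have h6 := hc (.cons x.tl.hd x.hd.hd)
      have h7 : (Data.cons x.tl.hd x.hd.hd).sz ^ c ≤ (2 * s.sz) ^ c := by
        refine Nat.pow_le_pow_left ?_ c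
        simp only [Data.sz, h1]
        have := x.hd.sz_hd_le
        have := s.sz_hd_le
        have := s.tl.sz_hd_le
        have := s.sz_tl_le
        omega
      simp only [List.length_cons, add_mul, one_mul] at h4
      omega
    · rw [e]; simp
  · rintro s x ⟨h1, -, h3, h4⟩
    have := x.sz_le
    have := x.tl.sz_le
    have := s.sz_hd_le
    have := s.sz_tl_le
    have := s.tl.sz_hd_le
    have := s.tl.sz_tl_le
    have h5 := Nat.mul_le_mul_right ((2 * s.sz) ^ c)
      (s.hd.length_toList_lt.le.trans s.sz_hd_le)
    rw [h1] at *
    omega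
  · exact PBound.sz.mono fun d => d.hd.length_toList_lt.le.trans d.sz_hd_le
  · rintro s x ⟨-, h2, -⟩ hx
    rw [← h2, hx]; rfl

/-- Folding with `cons` reverses the first list, so it is reversed beforehand by the same
construction. -/
theorem Poly.append {f g : Data → Data} (hf : Poly f) (hg : Poly g) :
    Poly fun d => Data.ofList ((f d).toList ++ (g d).toList) := by
  have key : ∀ {f g : Data → Data}, Poly f → Poly g →
      Poly fun d => Data.ofList ((f d).toList.reverse ++ (g d).toList) := by
    intro f g hf hg
    have := Poly.foldl (g := fun _ x acc => .cons x acc) hf hg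
      (Poly.id.tl.hd.cons Poly.id.tl.tl) PBound.sz (fun d x acc => by simp [Data.sz]; omega)
    convert this using 2 with d
    generalize g d = b
    induction (f d).toList generalizing b with
    | nil => simp
    | cons a l ih => simp [← ih]
  have := key (key hf .nil) hg
  simpa using this

/-- The elements of a list that satisfy a predicate. -/
noncomputable def Data.filter (P : Data → Prop) : Data → Data
  | nil => nil
  | cons a b => cond (P a) (cons a (filter P b)) (filter P b)

@[simp] theorem Data.mem_filter {P : Data → Prop} {L x : Data} :
    x ∈ (filter P L).toList ↔ x ∈ L.toList ∧ P x := by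
  induction L with
  | nil => simp [filter]
  | cons a b _ ih =>
    by_cases h : P a
    · simp only [filter, cond_pos h, toList_cons, List.mem_cons, ih]
      grind
    · simp only [filter, cond_neg h, toList_cons, List.mem_cons, ih]
      grind

theorem Data.sz_filter_le (P : Data → Prop) (L : Data) : (filter P L).sz ≤ L.sz := by
  induction L with
  | nil => simp [filter]
  | cons a b _ ih =>
    by_cases h : P a <;> simp only [filter, h, not_false_eq_true, cond_pos, cond_neg, sz] <;> omega

theorem Poly.filter {L : Data → Data} {P : Data → Data → Prop} (hL : Poly L)
    (hP : PolyDec fun e => P e.hd e.tl) : Poly fun d => (L d).filter (P d) := by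
  have := Poly.foldl (g := fun d x acc => Data.cond
      (P d x) (Data.ofList (acc.toList ++ (Data.cons x .nil).toList)) acc) hL .nil
    (PolyDec.ite (hP.comp (Poly.id.hd.cons Poly.id.tl.hd))
      (Poly.append Poly.id.tl.tl (Poly.id.tl.hd.cons .nil)) Poly.id.tl.tl)
    PBound.sz (fun d x acc => by
      by_cases h : P d x
      · simp only [Data.cond_pos h, Data.sz_ofList, Data.sz_eq_sum acc]
        simp [Data.sz]
        omega
      · simp [h])
  convert this using 2 with d
  have H : ∀ (l acc : Data), (l.toList.foldl (fun acc x => Data.cond (P d x)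
      (Data.ofList (acc.toList ++ (Data.cons x .nil).toList)) acc) acc) =
      .ofList (acc.toList ++ (l.filter (P d)).toList) := by
    intro l
    induction l with
    | nil => simp [Data.filter]
    | cons a l _ ih =>
      intro acc
      rw [Data.toList_cons, List.foldl_cons, ih]
      by_cases h : P d a <;> simp [h, Data.filter]
  rw [H]
  simp

theorem PolyDec.exists_mem {L : Data → Data} {P : Data → Data → Prop} (hL : Poly L)
    (hP : PolyDec fun e => P e.hd e.tl) : PolyDec fun d => ∃ x ∈ (L d).toList, P d x := by
  have := PolyDec.ne_nil (Poly.filter hL hP)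
  convert this using 2 with d
  rw [← Data.toList_ne_nil, List.ne_nil_iff_exists_cons]
  constructor
  · rintro ⟨x, hx, hP⟩
    exact List.ne_nil_iff_exists_cons.1 (List.ne_nil_of_mem (Data.mem_filter.2 ⟨hx, hP⟩))
  · rintro ⟨x, l, hl⟩
    exact ⟨x, Data.mem_filter.1 (hl ▸ List.mem_cons_self)⟩

theorem PolyDec.mem {f L : Data → Data} (hf : Poly f) (hL : Poly L) :
    PolyDec fun d => f d ∈ (L d).toList := by
  have := PolyDec.exists_mem hL (P := fun d x => x = f d)
    (PolyDec.eq Poly.id.tl (hf.comp Poly.id.hd))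
  simpa using this

theorem Poly.flatMap {L : Data → Data} {f : Data → Data → Data} (hL : Poly L)
    (hf : Poly fun e => f e.hd e.tl) :
    Poly fun d => Data.ofList ((L d).toList.flatMap fun x => (f d x).toList) := by
  have := Poly.foldl (g := fun d x acc => Data.ofList (acc.toList ++ (f d x).toList)) hL .nil
    (Poly.append Poly.id.tl.tl (hf.comp (Poly.id.hd.cons Poly.id.tl.hd)))
    hf.sz (fun d x acc => by
      simp only [Data.sz_ofList, Data.sz_eq_sum acc, Data.hd_cons, Data.tl_cons,
        Data.sz_eq_sum (f d x)]
      simp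
      omega)
  convert this using 2 with d
  have H : ∀ (l : List Data) (acc : Data), l.foldl (fun acc x =>
      Data.ofList (acc.toList ++ (f d x).toList)) acc =
      .ofList (acc.toList ++ l.flatMap fun x => (f d x).toList) := by
    intro l
    induction l with
    | nil => simp
    | cons a l ih => intro acc; simp [ih]
  simp [H]

theorem Poly.map {L : Data → Data} {f : Data → Data → Data} (hL : Poly L)
    (hf : Poly fun e => f e.hd e.tl) :
    Poly fun d => Data.ofList ((L d).toList.map (f d)) := by
  have := Poly.flatMap (f := fun d x => .cons (f d x) .nil) hL (hf.cons .nil)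
  simpa [List.flatMap_singleton', ← List.map_eq_flatMap] using this

/-! ### The algorithm -/

namespace Data

/-- The words in `U` that are concatenations of words from `F x`, where `x` runs through `l`. -/
noncomputable def catFold (U : Data) (F : Data → Data) (l : Data) : Data :=
  l.toList.foldl (fun acc x => U.filter fun M => ∃ m ∈ acc.toList, ∃ n ∈ (F x).toList,
    ofList (m.toList ++ n.toList) = M) (cons nil nil)

/-- The lists of states reached from the states `m` by popping the letter `a`, if `X` is a list of
triples (state, letter, list of states reached by popping the letter). -/
noncomputable def popLetter (U X a m : Data) : Data :=
  catFold U (fun q => U.filter fun n => cons q (cons a n) ∈ X.toList) m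

/-- The lists of states reached from the state `q` by popping the word `w`. -/
noncomputable def popWord (U X q w : Data) : Data :=
  w.toList.foldl (fun acc a => U.filter fun M => ∃ m ∈ acc.toList,
    M ∈ (popLetter U X a m).toList) (cons (cons q nil) nil)

/-- The lists of states reached from the targets `T` of a transition by popping their words. -/
noncomputable def popTargets (U X T : Data) : Data :=
  catFold U (fun u => popWord U X u.hd u.tl) T

/-- The smallest sublist of `P` that is closed under the rules given by `p`. -/
noncomputable def saturate (P : Data) (p : Data → Data → Prop) : Data :=
  P.toList.foldl (fun X _ => P.filter (p X)) nil

/-- The list `M` of states is reached by a pop from the state and letter of `z`, given `X`. -/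
def PopRule (Δ z₀ U X z : Data) : Prop :=
  z ∈ X.toList ∨ z = z₀ ∨ (z.tl.tl ≠ nil ∧ ∃ t ∈ Δ.toList, (z.hd = t.hd ∧ z.tl.hd = t.tl.hd) ∧
    z.tl.tl ∈ (popTargets U X t.tl.tl).toList)

/-- All triples of a left-hand side of a transition or of `z₀`, and a list of states. -/
def triples (Δ z₀ U : Data) : Data :=
  ofList ((cons z₀ Δ).toList.flatMap fun t =>
    (ofList (U.toList.map fun M => cons t.hd (cons t.tl.hd M))).toList)

/-- The additional state reached by popping `⊥` in the final state; it is not a numeral. -/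
def endState : Data := cons (cons nil nil) nil

/-- The final state, the letter `⊥`, and the list consisting of the additional state. -/
def endTriple (d : Data) : Data :=
  cons d.tl.tl.tl.tl.hd (cons d.tl.tl.tl.tl.tl.hd (cons endState nil))

/-- The list of transitions of an instance. -/
def transitions (d : Data) : Data := d.tl.tl.tl.tl.tl.tl.hd

/-- The saturated list of triples. -/
noncomputable def pops (d U : Data) : Data :=
  saturate (triples (transitions d) (endTriple d) U)
    (PopRule (transitions d) (endTriple d) U)

/-- The decision, given the list `U` of all relevant lists of states. -/
def Accepts (d U : Data) : Prop :=
  ∃ z ∈ (pops d U).toList, (z.hd = d.tl.tl.tl.hd ∧ z.tl.hd = d.tl.tl.tl.tl.tl.hd) ∧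
    ¬ ∃ x ∈ z.tl.tl.toList, ¬ x = endState

/-- The states in targets of transitions, and the additional state. -/
def targetStates (d : Data) : Data :=
  cons endState (ofList ((transitions d).toList.flatMap fun t =>
    (ofList (t.tl.tl.toList.map fun u => u.hd)).toList))

/-- The empty list and all lists with head in `S` and tail in `U`. -/
def extend (S U : Data) : Data :=
  cons nil (ofList (U.toList.flatMap fun m => (ofList (S.toList.map fun q => cons q m)).toList))

/-- All lists of length at most `j` with entries in `S`. -/
def words (S : Data) : ℕ → Data
  | 0 => cons nil nil
  | j + 1 => extend S (words S j)

end Data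

open Data

/-! ### The algorithm is polynomial in the instance and the list of words -/

theorem Poly.catFold {U l : Data → Data} {F : Data → Data → Data} (hU : Poly U)
    (hF : Poly fun e => F e.hd e.tl) (hl : Poly l) :
    Poly fun d => Data.catFold (U d) (F d) (l d) := by
  refine Poly.foldl (g := fun d x acc => (U d).filter fun M => ∃ m ∈ acc.toList,
    ∃ n ∈ (F d x).toList, ofList (m.toList ++ n.toList) = M) hl (.const _) ?_
    (b := fun e => (U e.hd).sz) (hU.comp Poly.id.hd).sz ?_
  · refine .filter (P := fun e M => ∃ m ∈ e.tl.tl.toList,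
      ∃ n ∈ (F e.hd e.tl.hd).toList, ofList (m.toList ++ n.toList) = M) (hU.comp Poly.id.hd) ?_
    refine .exists_mem (P := fun e m => ∃ n ∈ (F e.hd.hd e.hd.tl.hd).toList,
      ofList (m.toList ++ n.toList) = e.tl) Poly.id.hd.tl.tl ?_
    refine .exists_mem (P := fun e n => ofList (e.tl.toList ++ n.toList) = e.hd.tl)
      (hF.comp (Poly.id.hd.hd.hd.cons Poly.id.hd.hd.tl.hd)) ?_
    exact .eq (.append Poly.id.hd.tl Poly.id.tl) Poly.id.hd.hd.tl
  · intro d x acc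
    have := sz_filter_le (fun M => ∃ m ∈ acc.toList,
      ∃ n ∈ (F d x).toList, ofList (m.toList ++ n.toList) = M) (U d)
    simp only [hd_cons]
    omega

theorem Poly.popLetter {U X a m : Data → Data} (hU : Poly U) (hX : Poly X) (ha : Poly a)
    (hm : Poly m) : Poly fun d => Data.popLetter (U d) (X d) (a d) (m d) := by
  refine .catFold (F := fun d q => (U d).filter fun n => .cons q (.cons (a d) n) ∈ (X d).toList)
    hU ?_ hm
  refine .filter (P := fun e n => .cons e.tl (.cons (a e.hd) n) ∈ (X e.hd).toList)
    (hU.comp Poly.id.hd) ?_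
  exact .mem (Poly.id.hd.tl.cons ((ha.comp Poly.id.hd.hd).cons Poly.id.tl)) (hX.comp Poly.id.hd.hd)

theorem Poly.popWord {U X q w : Data → Data} (hU : Poly U) (hX : Poly X) (hq : Poly q)
    (hw : Poly w) : Poly fun d => Data.popWord (U d) (X d) (q d) (w d) := by
  refine Poly.foldl (g := fun d a acc => (U d).filter fun M => ∃ m ∈ acc.toList,
    M ∈ (Data.popLetter (U d) (X d) a m).toList) hw ((hq.cons .nil).cons .nil) ?_
    (b := fun e => (U e.hd).sz) (hU.comp Poly.id.hd).sz ?_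
  · refine .filter (P := fun e M => ∃ m ∈ e.tl.tl.toList,
      M ∈ (Data.popLetter (U e.hd) (X e.hd) e.tl.hd m).toList) (hU.comp Poly.id.hd) ?_
    refine .exists_mem (P := fun e m =>
      e.tl ∈ (Data.popLetter (U e.hd.hd) (X e.hd.hd) e.hd.tl.hd m).toList) Poly.id.hd.tl.tl ?_
    exact .mem Poly.id.hd.tl (.popLetter (hU.comp Poly.id.hd.hd.hd) (hX.comp Poly.id.hd.hd.hd)
      Poly.id.hd.hd.tl.hd Poly.id.tl)
  · intro d x acc
    have := sz_filter_le (fun M => ∃ m ∈ acc.toList,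
      M ∈ (Data.popLetter (U d) (X d) x m).toList) (U d)
    simp only [hd_cons]
    omega

theorem Poly.popTargets {U X T : Data → Data} (hU : Poly U) (hX : Poly X) (hT : Poly T) :
    Poly fun d => Data.popTargets (U d) (X d) (T d) :=
  .catFold (F := fun d u => Data.popWord (U d) (X d) u.hd u.tl) hU
    (.popWord (hU.comp Poly.id.hd) (hX.comp Poly.id.hd) Poly.id.tl.hd Poly.id.tl.tl) hT

theorem PolyDec.popRule {Δ z₀ U X z : Data → Data} (hΔ : Poly Δ) (hz₀ : Poly z₀) (hU : Poly U)
    (hX : Poly X) (hz : Poly z) : PolyDec fun d => PopRule (Δ d) (z₀ d) (U d) (X d) (z d) := by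
  refine .or (.mem hz hX) (.or (.eq hz hz₀) (.and (.ne_nil hz.tl.tl) ?_))
  refine .exists_mem (P := fun d t => ((z d).hd = t.hd ∧ (z d).tl.hd = t.tl.hd) ∧
    (z d).tl.tl ∈ (Data.popTargets (U d) (X d) t.tl.tl).toList) hΔ ?_
  have hz' := hz.comp Poly.id.hd
  exact .and (.and (.eq hz'.hd Poly.id.tl.hd) (.eq hz'.tl.hd Poly.id.tl.tl.hd))
    (.mem hz'.tl.tl (.popTargets (hU.comp Poly.id.hd) (hX.comp Poly.id.hd) Poly.id.tl.tl.tl))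

theorem Poly.triples {Δ z₀ U : Data → Data} (hΔ : Poly Δ) (hz₀ : Poly z₀) (hU : Poly U) :
    Poly fun d => Data.triples (Δ d) (z₀ d) (U d) := by
  refine .flatMap (L := fun d => .cons (z₀ d) (Δ d)) (f := fun d t =>
    ofList ((U d).toList.map fun M => .cons t.hd (.cons t.tl.hd M))) (hz₀.cons hΔ) ?_
  exact .map (f := fun e M => .cons e.tl.hd (.cons e.tl.tl.hd M)) (hU.comp Poly.id.hd)
    (Poly.id.hd.tl.hd.cons (Poly.id.hd.tl.tl.hd.cons Poly.id.tl))

theorem Poly.saturate {P : Data → Data} {p : Data → Data → Data → Prop} (hP : Poly P)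
    (hp : PolyDec fun e => p e.hd.hd e.hd.tl e.tl) :
    Poly fun d => Data.saturate (P d) (p d) := by
  refine Poly.foldl (g := fun d _ X => (P d).filter (p d X)) hP .nil ?_
    (b := fun e => (P e.hd).sz) (hP.comp Poly.id.hd).sz ?_
  · exact .filter (P := fun e => p e.hd e.tl.tl) (hP.comp Poly.id.hd)
      (hp.comp ((Poly.id.hd.hd.cons Poly.id.hd.tl.tl).cons Poly.id.tl))
  · intro d x acc
    have := sz_filter_le (p d acc) (P d)
    simp only [hd_cons]
    omega

theorem Poly.transitions : Poly Data.transitions := Poly.id.tl.tl.tl.tl.tl.tl.hd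

theorem Poly.endTriple : Poly Data.endTriple :=
  Poly.id.tl.tl.tl.tl.hd.cons (Poly.id.tl.tl.tl.tl.tl.hd.cons (.const _))

theorem Poly.pops : Poly fun e => Data.pops e.hd e.tl := by
  refine .saturate (P := fun e => Data.triples (Data.transitions e.hd) (Data.endTriple e.hd) e.tl)
    (p := fun e => PopRule (Data.transitions e.hd) (Data.endTriple e.hd) e.tl)
    (.triples (Poly.transitions.comp Poly.id.hd) (Poly.endTriple.comp Poly.id.hd) Poly.id.tl) ?_
  exact .popRule (Poly.transitions.comp Poly.id.hd.hd.hd) (Poly.endTriple.comp Poly.id.hd.hd.hd)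
    Poly.id.hd.hd.tl Poly.id.hd.tl Poly.id.tl

theorem PolyDec.accepts : PolyDec fun e => Accepts e.hd e.tl := by
  refine .exists_mem (P := fun e z => (z.hd = e.hd.tl.tl.tl.hd ∧
    z.tl.hd = e.hd.tl.tl.tl.tl.tl.hd) ∧ ¬ ∃ x ∈ z.tl.tl.toList, ¬ x = endState) .pops ?_
  have hd := Poly.id.hd.hd
  refine .and (.and (.eq Poly.id.tl.hd hd.tl.tl.tl.hd) (.eq Poly.id.tl.tl.hd
    hd.tl.tl.tl.tl.tl.hd)) (.not ?_)
  exact .exists_mem (P := fun _ x => ¬ x = endState) Poly.id.tl.tl.tl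
    (.not (.eq Poly.id.tl (.const _)))

theorem Poly.targetStates : Poly Data.targetStates := by
  refine .cons (.const _) (.flatMap (f := fun _ t => ofList (t.tl.tl.toList.map fun u => u.hd))
    .transitions ?_)
  exact .map (f := fun _ u => u.hd) Poly.id.tl.tl.tl Poly.id.tl.hd

theorem Poly.extend {S U : Data → Data} (hS : Poly S) (hU : Poly U) :
    Poly fun d => Data.extend (S d) (U d) := by
  refine .cons .nil (.flatMap (f := fun d m => ofList ((S d).toList.map fun q => .cons q m))
    hU ?_)
  exact .map (f := fun e q => .cons q e.tl) (hS.comp Poly.id.hd) (Poly.id.tl.cons Poly.id.hd.tl)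

/-! ### Specification of the algorithm -/

namespace Data

theorem filter_sublist {P Q : Data → Prop} {L : Data} (h : ∀ z ∈ L.toList, P z → Q z) :
    (filter P L).toList.Sublist (filter Q L).toList := by
  induction L with
  | nil => simp [filter]
  | cons a b _ ih =>
    simp only [toList_cons, List.mem_cons, forall_eq_or_imp] at h
    specialize ih h.2
    by_cases hp : P a
    · simpa [filter, hp, h.1 hp] using ih
    · by_cases hq : Q a
      · simpa [filter, hp, hq] using ih.cons a
      · simpa [filter, hp, hq] using ih

theorem filter_true (L : Data) : filter (fun _ => True) L = L := by
  induction L <;> simp_all [filter]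

theorem saturate_eq_iterate (P : Data) (p : Data → Data → Prop) :
    saturate P p = (fun X => P.filter (p X))^[P.toList.length] nil := by
  rw [← List.foldl_const]; rfl

theorem saturate_induction {P : Data} {p : Data → Data → Prop} (S : Data → Prop)
    (h : ∀ X, (∀ z ∈ X.toList, S z) → ∀ z ∈ P.toList, p X z → S z) :
    ∀ z ∈ (saturate P p).toList, S z := by
  rw [saturate_eq_iterate]
  generalize P.toList.length = n
  induction n with
  | zero => simp
  | succ n ih =>
    intro z hz
    rw [Function.iterate_succ_apply', mem_filter] at hz
    exact h _ ih z hz.1 hz.2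

/-- Only `hp`, that a round keeps what is already there, is needed, not monotonicity of `p` in `X`.
The rounds form an ascending chain of sublists of `P`; until it becomes stationary its length grows,
so `P.toList.length` rounds reach a fixed point. -/
theorem mem_saturate {P : Data} {p : Data → Data → Prop} (hp : ∀ X, ∀ z ∈ X.toList, p X z)
    {z : Data} (hz : z ∈ P.toList) (h : p (saturate P p) z) : z ∈ (saturate P p).toList := by
  set f : Data → Data := fun X => P.filter (p X) with hf
  have hsub : ∀ i, (f^[i] nil).toList.Sublist (f^[i + 1] nil).toList := by
    intro i
    cases i with
    | zero => simp
    | succ i =>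
      rw [Function.iterate_succ_apply', Function.iterate_succ_apply' f (i + 1)]
      refine filter_sublist fun z hz h => hp _ _ ?_
      rw [Function.iterate_succ_apply']
      exact mem_filter.2 ⟨hz, h⟩
  have hlen : ∀ i, (f^[i] nil).toList.length ≤ P.toList.length := by
    intro i
    have : (f^[i] nil).toList.Sublist P.toList := by
      cases i with
      | zero => simp
      | succ i =>
        rw [Function.iterate_succ_apply']
        conv_rhs => rw [← filter_true P]
        exact filter_sublist fun _ _ _ => trivial
    exact this.length_le
  have key : ∀ i, f^[i + 1] nil = f^[i] nil ∨ i < (f^[i + 1] nil).toList.length := by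
    intro i
    induction i with
    | zero =>
      by_cases h : f^[1] nil = nil
      · exact .inl h
      · exact .inr (List.length_pos_iff.2 (toList_ne_nil.2 h))
    | succ i ih =>
      rcases ih with ih | ih
      · left
        rw [Function.iterate_succ_apply', ih, ← Function.iterate_succ_apply' f, ih]
      · by_cases h : f^[i + 1 + 1] nil = f^[i + 1] nil
        · exact .inl h
        · right
          refine lt_of_le_of_lt ih (lt_of_le_of_ne (hsub _).length_le fun e => h ?_)
          -- Working with sublists rather than subsets lets equal lengths force equality.
          have := (hsub (i + 1)).eq_of_length e
          rw [← ofList_toList (f^[i + 1 + 1] nil), ← this, ofList_toList]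
  have hfix : f (saturate P p) = saturate P p := by
    rw [saturate_eq_iterate, ← Function.iterate_succ_apply' f]
    exact (key _).resolve_right (not_lt.2 (hlen _))
  rw [← hfix]
  exact mem_filter.2 ⟨hz, h⟩

/-! ### Popping letters and words, and the restriction to short lists -/

/-- `U` lists the words of length at most `k` over `S`. -/
def IsWords (k : ℕ) (S : Set Data) (U : Data) : Prop :=
  ∀ m, m ∈ U.toList ↔ m.toList.length ≤ k ∧ ∀ x ∈ m.toList, x ∈ S

theorem isWords_words (S : Data) (k : ℕ) : IsWords k {x | x ∈ S.toList} (words S k) := by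
  induction k with
  | zero =>
    intro m
    cases m <;> simp [words]
  | succ k ih =>
    intro m
    cases m with
    | nil => simp [words, extend]
    | cons a b => simp [words, extend, ih b]; tauto

theorem IsWords.of_sublist {k : ℕ} {S : Set Data} {U m n : Data} (hU : IsWords k S U)
    (h : m.toList.Sublist n.toList) (hn : n ∈ U.toList) : m ∈ U.toList := by
  rw [hU] at *
  exact ⟨h.length_le.trans hn.1, fun x hx => hn.2 x (h.subset hx)⟩

theorem IsWords.nil_mem {k : ℕ} {S : Set Data} {U : Data} (hU : IsWords k S U) :
    nil ∈ U.toList := (hU nil).2 (by simp)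

/-- Filtering by `U` after every concatenation loses nothing: each partial concatenation is a prefix
of the final word, and `U` is closed under sublists. -/
theorem mem_catFold {k : ℕ} {S : Set Data} {U : Data} (hU : IsWords k S U) {F : Data → Data}
    {l M : Data} : M ∈ (catFold U F l).toList ↔ M ∈ U.toList ∧ ∃ ns : List (List Data),
      List.Forall₂ (fun x n => ofList n ∈ (F x).toList) l.toList ns ∧ M.toList = ns.flatten := by
  unfold catFold
  have : ∀ (l : List Data) (acc : Data), (∀ m ∈ acc.toList, m ∈ U.toList) →
      (M ∈ (l.foldl (fun acc x => U.filter fun M => ∃ m ∈ acc.toList, ∃ n ∈ (F x).toList,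
        ofList (m.toList ++ n.toList) = M) acc).toList ↔ M ∈ U.toList ∧ ∃ m ∈ acc.toList,
        ∃ ns : List (List Data), List.Forall₂ (fun x n => ofList n ∈ (F x).toList) l ns ∧
          M.toList = m.toList ++ ns.flatten) := by
    intro l
    induction l with
    | nil =>
      intro acc hacc
      simp only [List.foldl_nil, List.forall₂_nil_left_iff, exists_eq_left, List.flatten_nil,
        List.append_nil]
      refine ⟨fun h => ⟨hacc _ h, _, h, rfl⟩, ?_⟩
      rintro ⟨-, m, hm, e⟩
      rwa [← ofList_toList M, e, ofList_toList]
    | cons a l ih =>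
      intro acc hacc
      rw [List.foldl_cons, ih _ (fun m hm => (mem_filter.1 hm).1)]
      refine and_congr_right fun hM => ?_
      constructor
      · rintro ⟨m, hm, ns, hns, e⟩
        obtain ⟨-, m', hm', n, hn, rfl⟩ := mem_filter.1 hm
        refine ⟨m', hm', n.toList :: ns, .cons (by simpa) hns, ?_⟩
        simpa using e
      · rintro ⟨m, hm, ns, hns, e⟩
        cases hns with
        | @cons _ n _ ns hn hns =>
          refine ⟨ofList (m.toList ++ n), mem_filter.2 ⟨hU.of_sublist ?_ hM, m, hm, _, hn, ?_⟩,
            ns, hns, ?_⟩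
          · rw [e]; simp
          · simp
          · simpa using e
  rw [this _ _ (by simpa using hU.nil_mem)]
  simp

/-- Popping the letter `a` from the states `m` may reach the states `M`. -/
def LetterPop (X : Data) (a : Data) (m M : List Data) : Prop :=
  ∃ ns : List (List Data), List.Forall₂ (fun q n => cons q (cons a (ofList n)) ∈ X.toList) m ns ∧
    M = ns.flatten

/-- Popping the word `w` from the states `m` may reach the states `M`. -/
def WordPop (X : Data) : List Data → List Data → List Data → Prop
  | [], m, M => m = M
  | a :: w, m, M => ∃ m', LetterPop X a m m' ∧ WordPop X w m' M

theorem mem_popLetter {k : ℕ} {S : Set Data} {U X a m M : Data} (hU : IsWords k S U) :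
    M ∈ (popLetter U X a m).toList ↔ M ∈ U.toList ∧ LetterPop X a m.toList M.toList := by
  unfold popLetter LetterPop
  rw [mem_catFold hU]
  refine and_congr_right fun hM => exists_congr fun ns => and_congr_left fun e => ?_
  have hns : ∀ n ∈ ns, ofList n ∈ U.toList := fun n hn => hU.of_sublist
    (by rw [e, toList_ofList]; exact List.sublist_flatten_of_mem hn) hM
  clear e
  simp only [mem_filter]
  induction ns generalizing m with
  | nil => cases m <;> simp
  | cons n ns ih =>
    cases m with
    | nil => simp
    | cons q m =>
      simp only [List.mem_cons, forall_eq_or_imp] at hns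
      simp only [toList_cons, List.forall₂_cons, hns.1, true_and, ih hns.2]

/-- The triples in `X` contain nonempty lists of states from `U`. -/
def IsTable (U X : Data) : Prop :=
  ∀ q a n, cons q (cons a n) ∈ X.toList → n ∈ U.toList ∧ n ≠ nil

theorem LetterPop.length_le {U X a : Data} {m M : List Data} (hX : IsTable U X)
    (h : LetterPop X a m M) : m.length ≤ M.length := by
  obtain ⟨ns, h, rfl⟩ := h
  induction h with
  | nil => simp
  | @cons q n m ns hn _ ih =>
    have := List.length_pos_iff.2 (toList_ne_nil.2 (hX _ _ _ hn).2)
    simp at this ih ⊢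
    omega

/-- Each state is replaced by a nonempty list, so no branch disappears. This is what permits
bounding all intermediate lists by the final one. -/
theorem WordPop.length_le {U X : Data} {w m M : List Data} (hX : IsTable U X)
    (h : WordPop X w m M) : m.length ≤ M.length := by
  induction w generalizing m with
  | nil => exact (congrArg List.length h).le
  | cons a w ih =>
    obtain ⟨m', h₁, h₂⟩ := h
    exact (h₁.length_le hX).trans (ih h₂)

theorem LetterPop.mem {k : ℕ} {S : Set Data} {U X a : Data} {m M : List Data}
    (hU : IsWords k S U) (hX : IsTable U X) (h : LetterPop X a m M) : ∀ x ∈ M, x ∈ S := by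
  obtain ⟨ns, h, rfl⟩ := h
  induction h with
  | nil => simp
  | @cons q n m ns hn _ ih =>
    have := ((hU _).1 (hX _ _ _ hn).1).2
    simp only [toList_ofList] at this
    simp only [List.flatten_cons, List.mem_append]
    rintro x (hx | hx)
    exacts [this x hx, ih x hx]

/-- The intermediate lists are not sublists of the final one, so their membership in `U` comes from
`WordPop.length_le` for the length and from the table `X` for the entries. -/
theorem mem_popWord {k : ℕ} {S : Set Data} {U X q w M : Data} (hU : IsWords k S U)
    (hX : IsTable U X) (hk : 1 ≤ k) (hq : q ∈ S) :
    M ∈ (popWord U X q w).toList ↔ M ∈ U.toList ∧ WordPop X w.toList [q] M.toList := by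
  unfold popWord
  have : ∀ (w : List Data) (acc : Data), (∀ m ∈ acc.toList, m ∈ U.toList) →
      (M ∈ (w.foldl (fun acc a => U.filter fun M => ∃ m ∈ acc.toList,
        M ∈ (popLetter U X a m).toList) acc).toList ↔ M ∈ U.toList ∧ ∃ m ∈ acc.toList,
          WordPop X w m.toList M.toList) := by
    intro w
    induction w with
    | nil =>
      intro acc hacc
      refine ⟨fun h => ⟨hacc _ h, _, h, rfl⟩, ?_⟩
      rintro ⟨-, m, hm, e⟩
      rw [← ofList_toList M, ← show m.toList = M.toList from e, ofList_toList]
      exact hm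
    | cons a w ih =>
      intro acc hacc
      rw [List.foldl_cons, ih _ (fun m hm => (mem_filter.1 hm).1)]
      refine and_congr_right fun hM => ?_
      constructor
      · rintro ⟨m, hm, h⟩
        obtain ⟨-, m', hm', h'⟩ := mem_filter.1 hm
        exact ⟨m', hm', m.toList, ((mem_popLetter hU).1 h').2, h⟩
      · rintro ⟨m, hm, m', h₁, h₂⟩
        have hm' : ofList m' ∈ U.toList := by
          rw [hU, toList_ofList]
          exact ⟨(h₂.length_le hX).trans ((hU _).1 hM).1, h₁.mem hU hX⟩
        exact ⟨ofList m', mem_filter.2 ⟨hm', m, hm, (mem_popLetter hU).2 ⟨hm', by simpa⟩⟩,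
          by simpa⟩
  rw [this _ _ (by simpa [hU _] using ⟨hk, hq⟩)]
  simp

theorem mem_popTargets {k : ℕ} {S : Set Data} {U X T M : Data} (hU : IsWords k S U)
    (hX : IsTable U X) (hk : 1 ≤ k) (hT : ∀ u ∈ T.toList, u.hd ∈ S) :
    M ∈ (popTargets U X T).toList ↔ M ∈ U.toList ∧ ∃ ns : List (List Data),
      List.Forall₂ (fun u n => WordPop X u.tl.toList [u.hd] n) T.toList ns ∧
        M.toList = ns.flatten := by
  unfold popTargets
  rw [mem_catFold hU]
  refine and_congr_right fun hM => exists_congr fun ns => and_congr_left fun e => ?_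
  have hns : ∀ n ∈ ns, ofList n ∈ U.toList := fun n hn => hU.of_sublist
    (by rw [e, toList_ofList]; exact List.sublist_flatten_of_mem hn) hM
  clear e
  induction ns generalizing T with
  | nil => cases T <;> simp
  | cons n ns ih =>
    cases T with
    | nil => simp
    | cons u T =>
      simp only [List.mem_cons, forall_eq_or_imp] at hns
      simp only [toList_cons, List.mem_cons, forall_eq_or_imp] at hT
      simp only [toList_cons, List.forall₂_cons, mem_popWord hU hX hk hT.1, hns.1, true_and,
        ih hT.2 hns.2, toList_ofList]

theorem LetterPop.append {X a : Data} {m m' M M' : List Data} (h : LetterPop X a m M)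
    (h' : LetterPop X a m' M') : LetterPop X a (m ++ m') (M ++ M') := by
  obtain ⟨ns, h, rfl⟩ := h
  obtain ⟨ns', h', rfl⟩ := h'
  exact ⟨ns ++ ns', List.rel_append h h', by simp⟩

theorem WordPop.append {X : Data} {w m m' M M' : List Data} (h : WordPop X w m M)
    (h' : WordPop X w m' M') : WordPop X w (m ++ m') (M ++ M') := by
  induction w generalizing m m' with
  | nil => exact congrArg₂ _ h h'
  | cons a w ih =>
    obtain ⟨n, h₁, h₂⟩ := h
    obtain ⟨n', h₁', h₂'⟩ := h'
    exact ⟨_, h₁.append h₁', ih h₂ h₂'⟩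

theorem WordPop.nil (X : Data) (w : List Data) : WordPop X w [] [] := by
  induction w with
  | nil => rfl
  | cons a w ih => exact ⟨[], ⟨[], .nil, rfl⟩, ih⟩

theorem wordPop_append {X : Data} {w w' m M : List Data} :
    WordPop X (w ++ w') m M ↔ ∃ m', WordPop X w m m' ∧ WordPop X w' m' M := by
  induction w generalizing m with
  | nil => simp [WordPop]
  | cons a w ih =>
    simp only [List.cons_append, WordPop, ih]
    grind

theorem mem_triples {Δ z₀ U z : Data} : z ∈ (triples Δ z₀ U).toList ↔
    ∃ t, (t = z₀ ∨ t ∈ Δ.toList) ∧ ∃ M ∈ U.toList, cons t.hd (cons t.tl.hd M) = z := by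
  simp [triples]

end Data

/-! ### Correctness -/

theorem Data.length_toList_ofNat (n : ℕ) : (ofNat n).toList.length = n := by
  induction n <;> simp_all [ofNat]

theorem Data.ofNat_injective : Function.Injective ofNat := fun m n h => by
  rw [← length_toList_ofNat m, h, length_toList_ofNat]

theorem Data.ofNat_ne_endState (n : ℕ) : ofNat n ≠ endState := by
  cases n <;> simp [ofNat, endState]

theorem LTree.numLeaves_node {C : Type*} (c : C) {cs : List (LTree C)} (h : cs ≠ []) :
    (node c cs).numLeaves = (cs.map numLeaves).sum := by
  simp [numLeaves, h]

theorem exists_eq_append_of_forall₂ {α β : Type*} {R : α → β → Prop} {l₁ l₂ : List α} {l : List β}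
    (h : List.Forall₂ R (l₁ ++ l₂) l) :
    ∃ m₁ m₂, l = m₁ ++ m₂ ∧ List.Forall₂ R l₁ m₁ ∧ List.Forall₂ R l₂ m₂ := by
  induction l₁ generalizing l with
  | nil => exact ⟨[], l, rfl, .nil, h⟩
  | cons a l₁ ih =>
    cases h with
    | cons hab h =>
      obtain ⟨m₁, m₂, rfl, h₁, h₂⟩ := ih h
      exact ⟨_ :: m₁, m₂, rfl, .cons hab h₁, h₂⟩

section

variable {Q Γ : Type*}

theorem APS.IsRun.one_le_numLeaves {A : APS Q Γ} {c : Q × List Γ} {t : LTree (Q × List Γ)}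
    (h : A.IsRun c t) : 1 ≤ t.numLeaves := by
  induction h with
  | leaf => simp [LTree.numLeaves]
  | fork p a γ T cs hT hne hlabels hcs ih =>
    rw [LTree.numLeaves_node _ hne]
    obtain ⟨t, cs, rfl⟩ := List.exists_cons_of_ne_nil hne
    have := ih t List.mem_cons_self
    simp
    omega

/-! ### Soundness: derivable triples give runs -/

/-- There is a run with `n` leaves from the configuration with the state encoded by `x` and the
stack `γ` to the final configuration, or `x` is the additional state and the stack is empty. -/
def Reaches (A : APS Q Γ) (νQ : Q → ℕ) (x : Data) (γ : List Γ) (n : ℕ) : Prop :=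
  (x = endState ∧ γ = [] ∧ n = 1) ∨ ∃ q t, x = ofNat (νQ q) ∧ t.label = (q, γ) ∧
    A.IsRun (A.final, [A.bot]) t ∧ t.numLeaves = n

/-- If the lower part of the stack can be emptied from all states in the list of `z`, then the
stack with the letter of `z` on top can be emptied from the state of `z`. -/
def IsSound (A : APS Q Γ) (νQ : Q → ℕ) (νΓ : Γ → ℕ) (z : Data) : Prop :=
  ∀ a γ ns, z.tl.hd = ofNat (νΓ a) →
    List.Forall₂ (fun x n => Reaches A νQ x γ n) z.tl.tl.toList ns →
    Reaches A νQ z.hd (a :: γ) ns.sum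

variable {A : APS Q Γ} {νQ : Q → ℕ} {νΓ : Γ → ℕ}

/-- The leaf counts are split along the blocks of `M`, one block per state of `m`, and the counts in
each block are added. -/
theorem Data.LetterPop.reaches {X : Data} (hX : ∀ z ∈ X.toList, IsSound A νQ νΓ z) {a : Γ}
    {m M : List Data} (h : LetterPop X (ofNat (νΓ a)) m M) {γ : List Γ} {ns : List ℕ}
    (hM : List.Forall₂ (fun x n => Reaches A νQ x γ n) M ns) :
    ∃ ns', List.Forall₂ (fun x n => Reaches A νQ x (a :: γ) n) m ns' ∧ ns'.sum = ns.sum := by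
  obtain ⟨Ms, h, rfl⟩ := h
  induction h generalizing ns with
  | nil =>
    cases hM
    exact ⟨[], .nil, rfl⟩
  | @cons q N m Ms hN _ ih =>
    rw [List.flatten_cons] at hM
    obtain ⟨ns₁, ns₂, rfl, hN', hM'⟩ := exists_eq_append_of_forall₂ hM
    obtain ⟨ns', h₁, h₂⟩ := ih hM'
    exact ⟨ns₁.sum :: ns', .cons (hX _ hN a γ _ rfl (by simpa using hN')) h₁, by simp [h₂]⟩

theorem Data.WordPop.reaches {X : Data} (hX : ∀ z ∈ X.toList, IsSound A νQ νΓ z) {w : List Γ}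
    {m M : List Data} (h : WordPop X (w.map fun a => ofNat (νΓ a)) m M) {γ : List Γ} {ns : List ℕ}
    (hM : List.Forall₂ (fun x n => Reaches A νQ x γ n) M ns) :
    ∃ ns', List.Forall₂ (fun x n => Reaches A νQ x (w ++ γ) n) m ns' ∧ ns'.sum = ns.sum := by
  induction w generalizing m with
  | nil =>
    obtain rfl : m = M := h
    exact ⟨ns, hM, rfl⟩
  | cons a w ih =>
    obtain ⟨m', h₁, h₂⟩ := h
    obtain ⟨ns', h₃, h₄⟩ := ih h₂
    obtain ⟨ns'', h₅, h₆⟩ := LetterPop.reaches hX h₁ h₃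
    exact ⟨ns'', h₅, h₆.trans h₄⟩

/-- Subtrees for the targets of a transition. -/
theorem exists_children (hν : Function.Injective νQ) {X : Data}
    (hX : ∀ z ∈ X.toList, IsSound A νQ νΓ z)
    {l : List (Q × List Γ)} {es : List Data} (hl : List.Forall₂ (EncodesTarget νQ νΓ) l es)
    {Ms : List (List Data)}
    (h : List.Forall₂ (fun u n => WordPop X u.tl.toList [u.hd] n) es Ms) {γ : List Γ} {ns : List ℕ}
    (hM : List.Forall₂ (fun x n => Reaches A νQ x γ n) Ms.flatten ns) :
    ∃ cs : List (LTree (Q × List Γ)), cs.map LTree.label = l.map (fun u => (u.1, u.2 ++ γ)) ∧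
      (∀ t ∈ cs, A.IsRun (A.final, [A.bot]) t) ∧ (cs.map LTree.numLeaves).sum = ns.sum := by
  induction hl generalizing Ms ns with
  | nil =>
    cases h
    cases hM
    exact ⟨[], rfl, by simp, rfl⟩
  | @cons u e l es hu _ ih =>
    cases h with
    | @cons _ N _ Ms hN hMs =>
      rw [List.flatten_cons] at hM
      obtain ⟨ns₁, ns₂, rfl, hN', hM'⟩ := exists_eq_append_of_forall₂ hM
      obtain ⟨cs, h₁, h₂, h₃⟩ := ih hMs hM'
      obtain rfl := hu
      simp only [tl_cons, toList_ofList, hd_cons] at hN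
      obtain ⟨ns', h₄, h₅⟩ := hN.reaches hX hN'
      obtain ⟨n, rfl⟩ : ∃ n, ns' = [n] := by
        cases h₄ with
        | cons _ h => cases h; exact ⟨_, rfl⟩
      -- The target of a transition is encoded with a numeral as its state, so it is not `endState`.
      obtain ⟨h, -⟩ | ⟨q, t, hq, ht, hr, hn⟩ := (List.forall₂_cons.1 h₄).1
      · exact absurd h (ofNat_ne_endState _)
      · obtain rfl := hν (ofNat_injective hq)
        refine ⟨t :: cs, by simp [ht, h₁], by simpa using ⟨hr, h₂⟩, ?_⟩
        simp [h₃, hn, ← h₅]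

theorem coe_eq_val {α : Type*} {l : List α} {S : Finset α} (hl : l.Nodup)
    (h : ∀ a, a ∈ l ↔ a ∈ S) : (l : Multiset α) = S.val :=
  (Multiset.Nodup.ext (Multiset.coe_nodup.2 hl) S.nodup).2 (by simpa using h)

theorem exists_of_forall₂_right {α β : Type*} {R : α → β → Prop} {l : List α} {m : List β}
    (h : List.Forall₂ R l m) {b : β} (hb : b ∈ m) : ∃ a ∈ l, R a b := by
  induction h with
  | nil => simp at hb
  | cons hab _ ih =>
    rcases List.mem_cons.1 hb with rfl | hb
    · exact ⟨_, List.mem_cons_self, hab⟩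
    · obtain ⟨a, ha, h⟩ := ih hb
      exact ⟨a, List.mem_cons_of_mem _ ha, h⟩

theorem exists_of_forall₂_left {α β : Type*} {R : α → β → Prop} {l : List α} {m : List β}
    (h : List.Forall₂ R l m) {a : α} (ha : a ∈ l) : ∃ b ∈ m, R a b :=
  exists_of_forall₂_right h.flip ha

theorem Data.WordPop.mem {k : ℕ} {S : Set Data} {U X : Data} {w m M : List Data}
    (hU : IsWords k S U) (hX : IsTable U X) (h : WordPop X w m M) (hm : ∀ x ∈ m, x ∈ S) :
    ∀ x ∈ M, x ∈ S := by
  induction w generalizing m with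
  | nil =>
    obtain rfl : m = M := h
    exact hm
  | cons a w ih =>
    obtain ⟨m', h₁, h₂⟩ := h
    exact ih h₂ (LetterPop.mem hU hX h₁)

/-- Nonemptiness also rules out transitions with empty right-hand side, which no run may use. -/
theorem pops_isTable (d U : Data) : IsTable U (pops d U) := by
  have : ∀ z ∈ (pops d U).toList, z.tl.tl ∈ U.toList ∧ z.tl.tl ≠ nil := by
    refine saturate_induction _ fun X hX z hz hr => ?_
    obtain ⟨t, -, M, hM, rfl⟩ := mem_triples.1 hz
    refine ⟨hM, ?_⟩
    rcases hr with h | h | h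
    · exact (hX _ h).2
    · rw [h]; simp [endTriple]
    · exact h.1
  exact fun q a n h => this _ h

theorem hd_mem_targetStates {d t u : Data} (ht : t ∈ (transitions d).toList)
    (hu : u ∈ t.tl.tl.toList) : u.hd ∈ (targetStates d).toList := by
  simp only [targetStates, toList_cons, toList_ofList, List.mem_cons, List.mem_flatMap,
    List.mem_map]
  exact .inr ⟨t, ht, u, hu, rfl⟩

theorem pops_isSound {d U : Data} {k : ℕ} (hU : IsWords k {x | x ∈ (targetStates d).toList} U)
    (hk : 1 ≤ k) (hνQ : Function.Injective νQ) (hνΓ : Function.Injective νΓ)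
    (hΔ : EncodesSet (EncodesTrans νQ νΓ) A.trans (transitions d))
    (hfin : d.tl.tl.tl.tl.hd = ofNat (νQ A.final))
    (hbot : d.tl.tl.tl.tl.tl.hd = ofNat (νΓ A.bot)) :
    ∀ z ∈ (pops d U).toList, IsSound A νQ νΓ z := by
  -- The table property is carried through the induction because `mem_popTargets` needs it for every
  -- intermediate `X`.
  have : ∀ z ∈ (pops d U).toList, (z.tl.tl ∈ U.toList ∧ z.tl.tl ≠ nil) ∧ IsSound A νQ νΓ z := by
    refine saturate_induction _ fun X hX z hz hr => ?_
    have htab : IsTable U X := fun q a n h => (hX _ h).1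
    have hX' : ∀ z ∈ X.toList, IsSound A νQ νΓ z := fun z hz => (hX z hz).2
    obtain ⟨t, -, M, hM, rfl⟩ := mem_triples.1 hz
    rcases hr with h | h | ⟨hne, t', ht', ⟨h₁, h₂⟩, hT⟩
    · exact hX _ h
    · refine ⟨⟨hM, by rw [h]; simp [endTriple]⟩, ?_⟩
      rw [h]
      intro a γ ns ha hns
      simp only [endTriple, tl_cons, hd_cons, toList_cons, toList_nil, hfin, hbot] at ha hns ⊢
      obtain rfl := hνΓ (ofNat_injective ha)
      obtain ⟨n, rfl⟩ : ∃ n, ns = [n] := by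
        cases hns with
        | cons _ h => cases h; exact ⟨_, rfl⟩
      -- Reaching `endState` forces the stack below ⊥ to be empty, so the configuration is the final
      -- one and a single leaf is a run.
      obtain ⟨-, rfl, rfl⟩ | ⟨q, t, hq, -⟩ := (List.forall₂_cons.1 hns).1
      · exact .inr ⟨_, _, rfl, rfl, .leaf, by simp [LTree.numLeaves]⟩
      · exact absurd hq.symm (ofNat_ne_endState _)
    · refine ⟨⟨hM, hne⟩, ?_⟩
      intro a γ ns ha hns
      simp only [tl_cons, hd_cons] at *
      rw [h₁]
      rw [ha] at h₂
      rw [mem_popTargets hU htab hk (fun u hu => hd_mem_targetStates ht' hu)] at hT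
      obtain ⟨-, Ms, hMs, hM'⟩ := hT
      obtain ⟨l, es, -, hl, hes, he⟩ := hΔ
      rw [he, toList_ofList] at ht'
      obtain ⟨⟨p, b, T⟩, hT, e, ⟨l', es', hnd, hl', hes', rfl⟩, rfl⟩ :=
        exists_of_forall₂_right hes ht'
      simp only [tl_cons, hd_cons, toList_ofList] at *
      obtain rfl := hνΓ (ofNat_injective h₂)
      rw [hM'] at hns
      obtain ⟨cs, c₁, c₂, c₃⟩ := exists_children hνQ hX' hes' hMs hns
      have hcs : cs ≠ [] := by
        rintro rfl
        obtain rfl : l' = [] := by simpa using c₁.symm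
        cases hes'
        cases hMs
        exact toList_ne_nil.2 hne hM'
      refine .inr ⟨p, .node (p, a :: γ) cs, rfl, rfl,
        .fork p a γ T cs ((hl _).1 hT) hcs ?_ c₂, ?_⟩
      · rw [c₁, ← coe_eq_val hnd hl']; rfl
      · rw [LTree.numLeaves_node _ hcs, c₃]
  exact fun z hz => (this z hz).2

/-! ### Completeness: runs give derivable triples -/

/-- Used to reorder the children of a vertex, known only as a multiset, into the order in which the
encoding lists the targets. -/
theorem exists_perm_map_eq {α β : Type*} {f : α → β} {l : List α} {m : List β}
    (h : (l.map f).Perm m) : ∃ l', l.Perm l' ∧ l'.map f = m := by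
  have : Relation.Comp (List.Forall₂ fun a b => f a = b) List.Perm l m :=
    ⟨l.map f, by simp [List.forall₂_map_right_iff, List.forall₂_same], h⟩
  rw [List.forall₂_comp_perm_eq_perm_comp_forall₂] at this
  obtain ⟨l', h₁, h₂⟩ := this
  refine ⟨l', h₁, ?_⟩
  rw [← List.forall₂_eq_eq_eq, List.forall₂_map_left_iff]
  exact h₂

/-- Splitting the pops from the targets of a transition at the lower part of the stack. -/
theorem exists_targets_pop {X : Data} {cs : List (LTree (Q × List Γ))} {l : List (Q × List Γ)}
    {es : List Data} (hl : List.Forall₂ (EncodesTarget νQ νΓ) l es) {γ : List Γ}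
    (hcs : cs.map LTree.label = l.map (fun u => (u.1, u.2 ++ γ)))
    (h : ∀ t ∈ cs, WordPop X (t.label.2.map fun a => ofNat (νΓ a)) [ofNat (νQ t.label.1)]
      (List.replicate t.numLeaves endState)) :
    ∃ Ms, List.Forall₂ (fun u n => WordPop X u.tl.toList [u.hd] n) es Ms ∧
      WordPop X (γ.map fun a => ofNat (νΓ a)) Ms.flatten
        (List.replicate (cs.map LTree.numLeaves).sum endState) := by
  induction hl generalizing cs with
  | nil =>
    obtain rfl : cs = [] := by simpa using hcs
    exact ⟨[], .nil, WordPop.nil _ _⟩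
  | @cons u e l es hu _ ih =>
    cases cs with
    | nil => simp at hcs
    | cons t cs =>
      simp only [List.map_cons, List.cons.injEq] at hcs
      simp only [List.mem_cons, forall_eq_or_imp] at h
      obtain ⟨Ms, h₁, h₂⟩ := ih hcs.2 h.2
      obtain ⟨ht, -⟩ := h
      rw [hcs.1, List.map_append, wordPop_append] at ht
      obtain ⟨N, h₃, h₄⟩ := ht
      obtain rfl := hu
      refine ⟨N :: Ms, .cons (by simpa using h₃) h₁, ?_⟩
      rw [List.flatten_cons, List.map_cons, List.sum_cons, List.replicate_add]
      exact h₄.append h₂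

theorem wordPop_of_isRun {d U : Data} {k : ℕ}
    (hU : IsWords k {x | x ∈ (targetStates d).toList} U) (hk : 1 ≤ k)
    (hΔ : EncodesSet (EncodesTrans νQ νΓ) A.trans (transitions d))
    (hfin : d.tl.tl.tl.tl.hd = ofNat (νQ A.final))
    (hbot : d.tl.tl.tl.tl.tl.hd = ofNat (νΓ A.bot)) {t : LTree (Q × List Γ)}
    (ht : A.IsRun (A.final, [A.bot]) t) (hkt : t.numLeaves ≤ k) :
    WordPop (pops d U) (t.label.2.map fun a => ofNat (νΓ a)) [ofNat (νQ t.label.1)]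
      (List.replicate t.numLeaves endState) := by
  have htab : IsTable U (pops d U) := pops_isTable d U
  have hclosed : ∀ z ∈ (triples (transitions d) (endTriple d) U).toList,
      PopRule (transitions d) (endTriple d) U (pops d U) z → z ∈ (pops d U).toList :=
    fun z hz h => mem_saturate (fun X z hz => .inl hz) hz h
  induction ht with
  | leaf =>
    refine ⟨[endState], ⟨[[endState]], .cons (hclosed _ ?_ (.inr (.inl ?_))) .nil, rfl⟩,
      by simp [LTree.numLeaves, WordPop]⟩
    · refine mem_triples.2 ⟨endTriple d, .inl rfl, _, (hU (ofList [endState])).2 ?_, ?_⟩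
      · simpa [targetStates] using hk
      · simp [endTriple, hfin, hbot, LTree.label]
    · simp [endTriple, hfin, hbot, LTree.label, ofList]
  | fork p a γ T cs hT hne hlabels _ ih =>
    rw [LTree.numLeaves_node _ hne] at hkt ⊢
    simp only [LTree.label]
    obtain ⟨l, es, -, hl, hes, he⟩ := hΔ
    obtain ⟨e, hemem, e', ⟨l', es', hnd, hl', hes', rfl⟩, rfl⟩ :=
      exists_of_forall₂_left hes ((hl _).2 hT)
    simp only at hl' hemem
    rw [← coe_eq_val hnd hl', Multiset.map_coe, Multiset.coe_eq_coe] at hlabels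
    obtain ⟨cs', hperm, hcs'⟩ := exists_perm_map_eq hlabels
    rw [(hperm.map LTree.numLeaves).sum_eq] at hkt ⊢
    obtain ⟨Ms, h₁, h₂⟩ := exists_targets_pop (X := pops d U) hes' hcs' fun t ht =>
      ih t (hperm.mem_iff.2 ht)
        ((List.single_le_sum (by simp) _ (List.mem_map_of_mem ht)).trans hkt)
    have hmem : (cons (ofNat (νQ p)) (cons (ofNat (νΓ a)) (ofList es'))) ∈ (transitions d).toList :=
      by rwa [he, toList_ofList]
    have hstates : ∀ u ∈ es', u.hd ∈ (targetStates d).toList := fun u hu =>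
      hd_mem_targetStates hmem (by simpa using hu)
    have hM : ofList Ms.flatten ∈ U.toList := by
      rw [hU, toList_ofList]
      -- Popping the remaining stack turns this list into one `endState` per leaf, so it has at most
      -- as many entries as there are leaves, hence at most `k`.
      refine ⟨(h₂.length_le htab).trans (by simpa using hkt), fun x hx => ?_⟩
      obtain ⟨N, hN, hx⟩ := List.mem_flatten.1 hx
      obtain ⟨u, hu, hN⟩ := exists_of_forall₂_right h₁ hN
      exact hN.mem hU htab (by simpa using hstates u hu) x hx
    have hne' : ofList Ms.flatten ≠ nil := by
      rw [← toList_ne_nil, toList_ofList]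
      have hes'' : es' ≠ [] := by
        rintro rfl
        cases hes'
        simp only [List.map_nil, List.map_eq_nil_iff] at hcs'
        subst hcs'
        exact hne (List.perm_nil.1 hperm)
      cases h₁ with
      | nil => exact absurd rfl hes''
      | cons h _ =>
        have := h.length_le htab
        intro h0
        simp_all
    refine ⟨Ms.flatten, ⟨[Ms.flatten], .cons (hclosed _ ?_ (.inr (.inr ⟨hne', _, hmem, ⟨rfl, rfl⟩,
      ?_⟩))) .nil, by simp⟩, h₂⟩
    · exact mem_triples.2 ⟨_, .inr hmem, _, hM, rfl⟩
    · rw [mem_popTargets hU htab hk (by simpa using hstates)]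
      exact ⟨hM, Ms, by simpa using h₁, by simp⟩

theorem accepts_iff {d U : Data} {k : ℕ}
    (hU : IsWords k {x | x ∈ (targetStates d).toList} U) (hk : 1 ≤ k)
    (hνQ : Function.Injective νQ) (hνΓ : Function.Injective νΓ)
    (hΔ : EncodesSet (EncodesTrans νQ νΓ) A.trans (transitions d))
    (hinit : d.tl.tl.tl.hd = ofNat (νQ A.initial))
    (hfin : d.tl.tl.tl.tl.hd = ofNat (νQ A.final))
    (hbot : d.tl.tl.tl.tl.tl.hd = ofNat (νΓ A.bot)) :
    Accepts d U ↔ A.HasSparseRun k := by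
  constructor
  · rintro ⟨z, hz, ⟨h₁, h₂⟩, h₃⟩
    -- With an empty stack below ⊥, every `endState` counts as one leaf, so the run obtained has as
    -- many leaves as the list has entries, and `U` bounds this by `k`.
    push Not at h₃
    have hs := pops_isSound hU hk hνQ hνΓ hΔ hfin hbot z hz A.bot []
      (List.replicate z.tl.tl.toList.length 1) (h₂.trans hbot) (by
        generalize z.tl.tl.toList = M at h₃
        induction M with
        | nil => exact .nil
        | cons x M ih =>
          simp only [List.mem_cons, forall_eq_or_imp] at h₃
          exact .cons (.inl ⟨h₃.1, rfl, rfl⟩) (ih h₃.2))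
    obtain ⟨h, -⟩ | ⟨q, t, hq, ht, hr, hn⟩ := hs
    · rw [h₁, hinit] at h
      exact absurd h (ofNat_ne_endState _)
    · rw [h₁, hinit] at hq
      obtain rfl := hνQ (ofNat_injective hq)
      refine ⟨t, ⟨ht, hr⟩, ?_⟩
      have hz' : z.tl.tl ∈ U.toList := by
        refine saturate_induction (fun z => z.tl.tl ∈ U.toList) (fun X hX z hz hr => ?_) z hz
        obtain ⟨t, -, M, hM, rfl⟩ := mem_triples.1 hz
        exact hM
      have := ((hU _).1 hz').1
      simp at hn
      omega
  · rintro ⟨t, ⟨ht, hr⟩, hk'⟩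
    have := wordPop_of_isRun hU hk hΔ hfin hbot hr hk'
    rw [ht] at this
    obtain ⟨m, ⟨Ms, hMs, rfl⟩, h⟩ := this
    obtain ⟨N, Ns, h₁, h₂, rfl⟩ := List.forall₂_cons_left_iff.1 hMs
    obtain rfl := List.forall₂_nil_left_iff.1 h₂
    have hN : N = List.replicate t.numLeaves endState := by simpa [WordPop] using h
    refine ⟨_, h₁, ⟨hinit.symm, hbot.symm⟩, ?_⟩
    simp [hN]

end

/-! ### Running time -/

theorem Data.sz_ofNat (n : ℕ) : (ofNat n).sz = 2 * n + 2 := by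
  induction n with
  | zero => rfl
  | succ n ih => simp only [ofNat, sz, ih]; omega

/-- The second factor `S.sz` is slack that absorbs the added empty list and the list terminators. -/
theorem Data.sz_extend_le (S U : Data) : (extend S U).sz ≤ S.sz ^ 2 * U.sz := by
  have hS := S.two_le_sz
  have hU := U.two_le_sz
  have h1 : ∀ m : Data, ((S.toList.map fun q => cons q m).map sz).sum ≤
      (S.toList.map sz).sum * m.sz := by
    intro m
    have hm := m.two_le_sz
    rw [← List.sum_map_mul_right, List.map_map]
    refine List.sum_le_sum fun q _ => ?_
    have hq := q.two_le_sz
    simp only [Function.comp_apply, sz]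
    nlinarith
  have h2 : ((U.toList.flatMap fun m => S.toList.map fun q => cons q m).map sz).sum ≤
      (S.toList.map sz).sum * (U.toList.map sz).sum := by
    induction U.toList with
    | nil => simp
    | cons m l ih =>
      simp only [List.flatMap_cons, List.map_append, List.sum_append, List.map_cons, List.sum_cons,
        mul_add]
      exact Nat.add_le_add (h1 m) ih
  simp only [extend, sz, sz_ofList, toList_ofList]
  have e1 := S.sz_eq_sum
  have e2 := U.sz_eq_sum
  have h3 := Nat.mul_le_mul (e1 ▸ Nat.le_add_right _ 2 : (S.toList.map sz).sum ≤ S.sz)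
    (e2 ▸ Nat.le_add_right _ 2 : (U.toList.map sz).sum ≤ U.sz)
  have h4 := Nat.mul_le_mul hS hU
  have h5 := Nat.mul_le_mul_right (S.sz * U.sz) hS
  calc _ ≤ 2 * (S.sz * U.sz) := by omega
    _ ≤ S.sz * (S.sz * U.sz) := h5
    _ = _ := by ring

theorem Data.sz_words_le (S : Data) (j : ℕ) : (words S j).sz ≤ 4 * (S.sz ^ 2) ^ j := by
  induction j with
  | zero => simp [words, sz]
  | succ j ih =>
    refine (sz_extend_le _ _).trans ?_
    exact (Nat.mul_le_mul_left (S.sz ^ 2) ih).trans_eq (by ring)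

/-- One step of the computation of `words`; the state consists of a counter, the instance, and the
list computed so far. -/
def Data.wordsStep (x : Data) : Data :=
  cons x.hd.tl (cons x.tl.hd (extend (targetStates x.tl.hd) x.tl.tl))

theorem Poly.wordsStep : Poly Data.wordsStep :=
  Poly.id.hd.tl.cons (Poly.id.tl.hd.cons
    (.extend (Poly.targetStates.comp Poly.id.tl.hd) Poly.id.tl.tl))

/-- The program for `k ≥ 1`. -/
theorem exists_prog : ∃ (p : Prog) (c : ℕ), ∀ (k : ℕ) (s : Store), 1 ≤ k → (s 0).hd = ofNat k →
    ∃ s' n, Exec p s s' n ∧ s' 0 = bool (Accepts (s 0) (words (targetStates (s 0)) k)) ∧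
      n ≤ ((s 0).sz ^ k) ^ c := by
  have hinit : Poly fun d => .cons d.hd (.cons d (.cons .nil .nil)) :=
    Poly.id.hd.cons (Poly.id.cons (.const _))
  have hdec : Poly fun x => bool (Accepts x.tl.hd x.tl.tl) := PolyDec.accepts.comp Poly.id.tl
  obtain ⟨p₁, c₁, h₁, -⟩ := hinit
  obtain ⟨p₂, c₂, h₂, -⟩ := Poly.wordsStep
  obtain ⟨p₃, c₃, h₃, -⟩ := hdec
  obtain ⟨a, ha⟩ := Poly.targetStates.sz
  -- The exponent records the nesting of `add_le_pow` and `mul_le_pow` in the final estimate, with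
  -- base `d.sz ^ k`.
  refine ⟨.seq p₁ (.seq p₂.whileHd p₃), c₁ + (1 + ((2 * a + 6) * c₂ + 2 + 1) + 2 + 1 +
    (2 * a + 6) * c₃ + 1) + 1, fun k s hk hs => ?_⟩
  set d := s 0
  have hd2 := d.two_le_sz
  have hY : 2 ≤ d.sz ^ k := hd2.trans (Nat.le_self_pow (by omega) _)
  have hdY : d.sz ≤ d.sz ^ k := Nat.le_self_pow (by omega) _
  have hkY : k ≤ d.sz ^ k := Nat.lt_two_pow_self.le.trans (Nat.pow_le_pow_left hd2 k)
  have hkd : (ofNat k).sz ≤ d.sz := hs ▸ d.sz_hd_le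
  -- The states of this loop have size `d.sz ^ O(k)`, which is not polynomial in `d`, so
  -- `Exec.whileHd` is applied directly instead of `Poly.whileHd`.
  let I : Data → Prop := fun x => ∃ i j, i + j = k ∧
    x = .cons (ofNat i) (.cons d (words (targetStates d) j))
  have hIsz : ∀ x, I x → x.sz ≤ (d.sz ^ k) ^ (2 * a + 6) := by
    rintro x ⟨i, j, hij, rfl⟩
    have e1 : (ofNat i).sz ≤ (ofNat k).sz := by rw [sz_ofNat, sz_ofNat]; omega
    have e2 : (words (targetStates d) j).sz ≤ 4 * (d.sz ^ k) ^ (2 * a) := by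
      refine (sz_words_le _ _).trans (Nat.mul_le_mul_left _ ?_)
      calc ((targetStates d).sz ^ 2) ^ j ≤ ((d.sz ^ a) ^ 2) ^ j :=
            Nat.pow_le_pow_left (Nat.pow_le_pow_left (ha d) 2) j
        _ ≤ ((d.sz ^ a) ^ 2) ^ k := Nat.pow_le_pow_right (by positivity) (by omega)
        _ = (d.sz ^ k) ^ (2 * a) := by ring
    have e3 : 4 * (d.sz ^ k) ^ (2 * a) ≤ (d.sz ^ k) ^ (2 + 2 * a) :=
      mul_le_pow (by nlinarith) le_rfl
    have e4 : d.sz ≤ (d.sz ^ k) ^ 1 := by simpa using hdY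
    have := add_le_pow hY e4 (add_le_pow hY e4 e3)
    simp only [sz]
    refine le_trans ?_ (this.trans (Nat.pow_le_pow_right (by omega) (by omega)))
    omega
  obtain ⟨s₁, n₁, x₁, e₁, b₁⟩ := h₁ s
  have hI : ∀ x, I x → x.hd ≠ .nil → I (Data.wordsStep x) ∧
      (Data.wordsStep x).hd.toList.length < x.hd.toList.length ∧
      x.sz ^ c₂ ≤ ((d.sz ^ k) ^ (2 * a + 6)) ^ c₂ := by
    intro x hx hn
    have hsz := Nat.pow_le_pow_left (hIsz x hx) c₂
    obtain ⟨i, j, hij, rfl⟩ := hx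
    cases i with
    | zero => exact absurd rfl hn
    | succ i => exact ⟨⟨i, j + 1, by omega, rfl⟩, by simp [Data.wordsStep, ofNat], hsz⟩
  obtain ⟨s₂, n₂, x₂, ⟨i, j, hij, e₂⟩, hn, b₂⟩ := Exec.whileHd h₂ I
    (fun x => x.hd.toList.length) _ hI s₁ ⟨k, 0, rfl, by rw [e₁, ← hs]; rfl⟩
  obtain ⟨s₃, n₃, x₃, e₃, b₃⟩ := h₃ s₂
  have b₃' := b₃.trans (Nat.pow_le_pow_left (hIsz _ ⟨i, j, hij, e₂⟩) c₃)
  obtain rfl : i = 0 := by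
    rw [e₂] at hn
    cases i with
    | zero => rfl
    | succ i => simp [ofNat] at hn
  obtain rfl : j = k := by omega
  refine ⟨s₃, _, .seq x₁ (.seq x₂ x₃), by rw [e₃, e₂]; rfl, ?_⟩
  have hk' : (s₁ 0).hd.toList.length = j := by
    rw [e₁, hd_cons, hs, length_toList_ofNat]
  simp only [hk'] at b₂
  have h4 : 4 ≤ (d.sz ^ j) ^ 2 := by nlinarith
  rw [← pow_mul] at b₂ b₃'
  refine (Nat.add_le_add b₁ (Nat.add_le_add b₂ b₃')).trans ?_
  exact add_le_pow hY (Nat.pow_le_pow_left hdY c₁) (add_le_pow hY (add_le_pow hY (mul_le_pow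
    (by simpa using hkY : j ≤ (d.sz ^ j) ^ 1) (add_le_pow hY le_rfl h4)) h4) le_rfl)

/-! ### Size of an encoded instance -/

section

variable {Q Γ : Type*} [Fintype Q] [Fintype Γ]

theorem APS.two_le_size (A : APS Q Γ) : 2 ≤ A.size := by
  have h1 : 0 < Fintype.card Q := Fintype.card_pos_iff.2 ⟨A.initial⟩
  have h2 : 0 < Fintype.card Γ := Fintype.card_pos_iff.2 ⟨A.bot⟩
  unfold APS.size
  omega

theorem sz_ofList_le_of_forall₂ {α : Type*} {R : α → Data → Prop} {l : List α} {es : List Data}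
    (h : List.Forall₂ R l es) (f : α → ℕ) (hf : ∀ a e, R a e → e.sz ≤ f a) :
    (ofList es).sz ≤ (l.map f).sum + 2 := by
  rw [sz_ofList]
  induction h with
  | nil => simp
  | cons hab _ ih =>
    have := hf _ _ hab
    simp only [List.map_cons, List.sum_cons]
    omega

theorem EncodesSet.sz_le {α : Type*} {R : α → Data → Prop} {S : Finset α} {d : Data}
    (h : EncodesSet R S d) (f : α → ℕ) (hf : ∀ a e, R a e → e.sz ≤ f a) :
    d.sz ≤ ∑ a ∈ S, f a + 2 := by
  obtain ⟨l, es, hnd, hl, hes, rfl⟩ := h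
  refine (sz_ofList_le_of_forall₂ hes f hf).trans (le_of_eq ?_)
  rw [Finset.sum, ← coe_eq_val hnd hl]
  rfl

/-- Apart from `k`, the encoding is quadratic in |A|, each occurrence costing a unary number of
linear size. The exponent must grow with `k` only because `k` itself is unary and may far exceed
|A|. -/
theorem EncodesInstance.sz_le {A : APS Q Γ} {k : ℕ} {d : Data} (h : EncodesInstance A k d)
    (hk : 1 ≤ k) : d.sz ≤ A.size ^ (8 * k) := by
  obtain ⟨νQ, νΓ, e, he, rfl⟩ := h
  set s := A.size with hs
  have h2 : 2 ≤ s := A.two_le_size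
  have hQ : ∀ q, (ofNat (νQ q : ℕ)).sz ≤ 2 * s := fun q => by
    have := (νQ q).isLt
    rw [sz_ofNat, hs, APS.size]
    omega
  have hΓ : ∀ a, (ofNat (νΓ a : ℕ)).sz ≤ 2 * s := fun a => by
    have := (νΓ a).isLt
    rw [sz_ofNat, hs, APS.size]
    omega
  have hsum : ∑ t ∈ A.trans, (2 + ∑ u ∈ t.2.2, (1 + u.2.length)) ≤ s := by
    rw [hs, APS.size]; omega
  have he' : e.sz ≤ 3 * s * s + 2 := by
    refine (he.sz_le (fun t => 3 * s * (2 + ∑ u ∈ t.2.2, (1 + u.2.length))) ?_).trans ?_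
    · rintro ⟨q, a, T⟩ _ ⟨e', hT, rfl⟩
      have := hT.sz_le (fun u => 3 * s * (1 + u.2.length)) (by
        rintro ⟨q, w⟩ _ rfl
        have h3 : ((w.map fun a => ofNat (νΓ a : ℕ)).map sz).sum ≤ w.length * (2 * s) := by
          refine (List.sum_le_card_nsmul _ (2 * s) ?_).trans (by simp)
          simpa using fun a _ => hΓ a
        have := hQ q
        simp only [sz, sz_ofList]
        nlinarith)
      rw [← Finset.mul_sum] at this
      have := hQ q
      have := hΓ a
      simp only [sz]
      nlinarith
    · rw [← Finset.mul_sum]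
      exact Nat.add_le_add_right (Nat.mul_le_mul_left _ hsum) 2
  have hcQ : (ofNat (Fintype.card Q)).sz ≤ 2 * s + 2 := by
    rw [sz_ofNat, hs, APS.size]; omega
  have hcΓ : (ofNat (Fintype.card Γ)).sz ≤ 2 * s + 2 := by
    rw [sz_ofNat, hs, APS.size]; omega
  have hi := hQ A.initial
  have hf := hQ A.final
  have hb := hΓ A.bot
  have hkk : 2 * k ≤ s ^ (1 + k) := mul_le_pow (by simpa using h2)
    (Nat.lt_two_pow_self.le.trans (Nat.pow_le_pow_left h2 k))
  have h32 : 32 ≤ s ^ 5 := Nat.pow_le_pow_left h2 5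
  have hmul : 32 * (s * s) ≤ s ^ (5 + 2) := mul_le_pow h32 (by rw [sq])
  calc _ ≤ 2 * k + 32 * (s * s) := by
        simp only [ofList, sz, sz_ofNat k]
        nlinarith
    _ ≤ s ^ (7 * k) + s ^ (7 * k) := Nat.add_le_add
        (hkk.trans (Nat.pow_le_pow_right (by omega) (by omega)))
        (hmul.trans (Nat.pow_le_pow_right (by omega) (by omega)))
    _ ≤ s ^ (7 * k + 1) := by
        rw [pow_succ, ← mul_two]
        exact Nat.mul_le_mul_left _ h2
    _ ≤ s ^ (8 * k) := Nat.pow_le_pow_right (by omega) (by omega)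

end

end SparseEmpty

theorem mainTheorem3 :
    ∃ (P : SparseEmpty.Prog) (C c : ℕ),
      ∀ (Q Γ : Type*) [Fintype Q] [Fintype Γ] (A : SparseEmpty.APS Q Γ) (k : ℕ)
        (d : SparseEmpty.Data), SparseEmpty.EncodesInstance A k d →
        ∃ (out : SparseEmpty.Data) (n : ℕ), SparseEmpty.Computes P d out n ∧
          (out ≠ SparseEmpty.Data.nil ↔ A.HasSparseRun k) ∧
          n ≤ C * A.size ^ (c * k ^ 2) := by
  open SparseEmpty in
  obtain ⟨p, c, hp⟩ := exists_prog
  -- For `k = 0` the time bound is just `C`, so this case is rejected separately in exactly 6 time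
  -- units; every run has at least one leaf.
  refine ⟨.seq (.assign 1 (.hd (.var 0))) (.ite 1 p (.assign 0 .nil)), 6, 8 * c, ?_⟩
  intro Q Γ _ _ A k d hd
  set s : Store := Function.update (fun _ => Data.nil) 0 d
  set s₁ : Store := Function.update s 1 d.hd
  have hs₁ : s₁ 0 = d := by simp [s₁, s]
  have x₁ : Exec (.assign 1 (.hd (.var 0))) s s₁ 3 := by
    simpa [s₁, s, Expr.eval, Expr.cost] using Exec.assign 1 (.hd (.var 0)) s
  have hdk : d.hd = .ofNat k := by
    obtain ⟨_, _, _, _, rfl⟩ := hd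
    rfl
  have h2 := A.two_le_size
  rcases Nat.eq_zero_or_pos k with rfl | hk
  · refine ⟨.nil, _, ⟨_, .seq x₁ (.ite_else ?_ (.assign _ _ _)), by simp [Expr.eval]⟩, ?_, ?_⟩
    · simpa [s₁, Data.ofNat] using hdk
    · simp only [ne_eq, not_true_eq_false, false_iff]
      rintro ⟨t, ⟨-, ht⟩, h⟩
      have := ht.one_le_numLeaves
      omega
    · simp [Expr.cost]
  · obtain ⟨s₂, n, x₂, e, b⟩ := hp k s₁ hk (by rw [hs₁, hdk])
    refine ⟨_, _, ⟨s₂, .seq x₁ (.ite_then ?_ x₂), rfl⟩, ?_, ?_⟩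
    · obtain ⟨k, rfl⟩ := Nat.exists_eq_add_one.2 hk
      simp [s₁, hdk, Data.ofNat]
    · rw [e, Data.bool_ne_nil, hs₁]
      obtain ⟨νQ, νΓ, e, he, rfl⟩ := hd
      exact accepts_iff (Data.isWords_words _ _) hk (Fin.val_injective.comp νQ.injective)
        (Fin.val_injective.comp νΓ.injective) he rfl rfl rfl
    · rw [hs₁] at b
      have h3 : (d.sz ^ k) ^ c ≤ A.size ^ (8 * c * k ^ 2) := by
        calc (d.sz ^ k) ^ c ≤ ((A.size ^ (8 * k)) ^ k) ^ c :=
              Nat.pow_le_pow_left (Nat.pow_le_pow_left (hd.sz_le hk) k) c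
          _ = A.size ^ (8 * c * k ^ 2) := by ring
      have h4 : 1 ≤ A.size ^ (8 * c * k ^ 2) := Nat.one_le_pow _ _ (by omega)
      omega
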